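/- Let $\mathbb H=\{z\in\mathbb C:\operatorname{Im}z>0\}$, $\rho\in\mathbb R$ and $z_0\in\overline{\mathbb H}\setminus\{0\}$. The chordal SLE$_0(\rho)$ in $\mathbb H$, starting at $0$, with reference point $\infty$ and force point $z_0$, is the curve $\gamma:[0,\tau)\to\overline{\mathbb H}$ with $\gamma(t)=\lim_{y\to0+}g_t^{-1}(W_t+iy)$. Here $g_t$ is the Loewner flow $\partial_tg_t(z)=\frac{2}{g_t(z)-W_t}$, $g_0(z)=z$, whose driving function $W$ solves $$\dot W_t=\operatorname{Re}\frac{\rho}{W_t-z_t},\qquad W_0=0,\qquad z_t=g_t(z_0),$$ up to the time $\tau=\lim_{\varepsilon\to0+}\inf\{t>0:|W_t-z_t|=\varepsilon\}\in(0,\infty]$. **Proposition.** The SLE$_0(\rho)$ curve $\gamma$ exists, is continuous on $[0,\tau)$ with $\gamma(0)=0$, and $\gamma([0,t])$ has finite length for every $t<\tau$. Let $L\in(0,\infty]$ be its total length and $\eta:[0,L)\to\overline{\mathbb H}$ its parametrization by arc length. 1. If $z_0\in\mathbb R\setminus\{0\}$, let $h_{\rho,z_0}:\mathbb H\to\mathbb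 R$ be $$h_{\rho,z_0}(z)=\begin{cases}\pi\left(1+\tfrac\rho2\right)-\arg z-\tfrac\rho2\arg(z-z_0),&z_0>0,\\ \pi-\arg z-\tfrac\rho2\arg(z-z_0),&z_0<0,\end{cases}$$ where the arguments take values in $(0,\pi)$. Then $\eta$ is a flow line of $h_{\rho,z_0}$: on $(0,L)$ it is a $C^1$ curve in $\mathbb H$, parametrized by arc length, and $\eta'(s)=e^{ih_{\rho,z_0}(\eta(s))}$. 2. If $z_0=re^{i\theta}\in\mathbb H$ with $r>0$, $\theta\in(0,\pi)$, let $M_{z_0}=\{(R,\phi):R>0,\ \phi\in\mathbb R\}$ be the logarithmic Riemann surface centered at $z_0$, with projection $\pi_{z_0}(R,\phi)=z_0+Re^{i\phi}$ and the complex structure induced by $\pi_{z_0}$. On $\pi_{z_0}^{-1}(\mathbb H)$ define the field $$h_{\rho,z_0}(z)=\pi-\arg z-\tfrac\rho4\bigl(\arg(z-z_0)+\arg(z-\bar z_0)\bigr),$$ where at the point $(R,\phi)$ one puts $z=z_0+Re^{i\phi}$ and $\arg(z-z_0)=\phi$, and where $\arg z$ and $\arg(z-\bar z_0)$ take values in $(0,\pi)$.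 Then $\eta$ has a continuous lift $\tilde\eta:[0,L)\to M_{z_0}$ by $\pi_{z_0}$ starting at $\tilde\eta(0)=(r,\theta-\pi)$, and $\tilde\eta$ is a flow line of $h_{\rho,z_0}$: on $(0,L)$ it is a $C^1$ curve in $\pi_{z_0}^{-1}(\mathbb H)$, parametrized by arc length, and $\tilde\eta'(s)=e^{ih_{\rho,z_0}(\tilde\eta(s))}$, where derivative and arc length are taken in the charts given by $\pi_{z_0}$. -/

import Mathlib

open scoped ENNReal Topology

noncomputable section

namespace SLEZero

/-- The half-open interval `[0, τ)`, where `τ` may be infinite. -/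
def halfOpen (τ : ℝ≥0∞) : Set ℝ := {t | 0 ≤ t ∧ ENNReal.ofReal t < τ}

/-- The open interval `(0, τ)`, where `τ` may be infinite. -/
def openInterval (τ : ℝ≥0∞) : Set ℝ := {t | 0 < t ∧ ENNReal.ofReal t < τ}

/-- The open upper half-plane. -/
def upperHalf : Set ℂ := {z | 0 < z.im}

/-! ### The chordal Loewner equation -/

/-- On the time interval `J` (which contains `0`), `u` solves the chordal Loewner equation
`∂ₜ u = 2 / (u - W)` with driving function `W` and initial value `z`. -/
structure IsLoewnerOrbit (W : ℝ → ℝ) (J : Set ℝ) (z : ℂ) (u : ℝ → ℂ) : Prop where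
  initial : u 0 = z
  ne_driving : ∀ s ∈ J, u s ≠ (W s : ℂ)
  hasDeriv : ∀ s ∈ J, HasDerivWithinAt u (2 / (u s - (W s : ℂ))) J s

/-- The set `ℍ \ Kₜ`: the points of the upper half-plane from which the Loewner equation can be
solved up to and including time `t`. -/
def loewnerDomain (W : ℝ → ℝ) (t : ℝ) : Set ℂ :=
  {z | z ∈ upperHalf ∧ ∃ u : ℝ → ℂ, IsLoewnerOrbit W (Set.Icc 0 t) z u}

open Classical in
/-- The mapping-out function `gₜ`: the value at time `t` of the (unique) solution of the Loewner
equation started at `z`. It is `0`, a junk value, if there is no solution up to time `t`. -/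
def loewnerMap (W : ℝ → ℝ) (t : ℝ) (z : ℂ) : ℂ :=
  if h : ∃ u : ℝ → ℂ, IsLoewnerOrbit W (Set.Icc 0 t) z u then h.choose t else 0

/-- The inverse of the conformal map `gₜ : ℍ \ Kₜ → ℍ`. -/
def loewnerInv (W : ℝ → ℝ) (t : ℝ) (w : ℂ) : ℂ :=
  Function.invFunOn (loewnerMap W t) (loewnerDomain W t) w

/-- `γ` is, on the time interval `J`, the curve generated by `W`:
`γ(t) = lim_{y → 0+} gₜ⁻¹(Wₜ + i y)`, where the limit is required to exist. -/
def IsLoewnerTrace (W : ℝ → ℝ) (J : Set ℝ) (γ : ℝ → ℂ) : Prop :=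
  ∀ t ∈ J, Filter.Tendsto (fun y : ℝ => loewnerInv W t ((W t : ℂ) + (y : ℂ) * Complex.I))
    (𝓝[>] 0) (𝓝 (γ t))

/-! ### Chordal SLE₀(ρ) -/

/-- `inf {t > 0 : |Wₜ - Zₜ| = ε}` for functions living on `[0, τ)`; it is `∞` if the set is
empty. -/
def approachTime (τ : ℝ≥0∞) (W : ℝ → ℝ) (Z : ℝ → ℂ) (ε : ℝ) : ℝ≥0∞ :=
  sInf (ENNReal.ofReal '' {t | t ∈ openInterval τ ∧ ‖(W t : ℂ) - Z t‖ = ε})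

/-- `W` is the driving function, on its whole lifetime `[0, τ)`, of chordal SLE₀(ρ) in the upper
half-plane started at `0`, with reference point `∞` and force point `z₀`, and `Zₜ = gₜ(z₀)` is the
evolution of the force point. The last field says that `τ` is the limit, as `ε → 0+`, of the first
times at which `|W - Z| = ε`. -/
structure IsSLEZeroDriving (ρ : ℝ) (z₀ : ℂ) (τ : ℝ≥0∞) (W : ℝ → ℝ) (Z : ℝ → ℂ) : Prop where
  lifetime_pos : 0 < τ
  initial : W 0 = 0
  forcePoint : IsLoewnerOrbit W (halfOpen τ) z₀ Z
  drift : ∀ t ∈ halfOpen τ,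
    HasDerivWithinAt W ((ρ : ℂ) / ((W t : ℂ) - Z t)).re (halfOpen τ) t
  lifetime : Filter.Tendsto (approachTime τ W Z) (𝓝[>] 0) (𝓝 τ)

/-- `γ : [0, τ) → ℂ` is the chordal SLE₀(ρ) in the upper half-plane started at `0`, with reference
point `∞` and force point `z₀`, parametrized by half-plane capacity. -/
def IsSLEZero (ρ : ℝ) (z₀ : ℂ) (τ : ℝ≥0∞) (γ : ℝ → ℂ) : Prop :=
  ∃ (W : ℝ → ℝ) (Z : ℝ → ℂ), IsSLEZeroDriving ρ z₀ τ W Z ∧ IsLoewnerTrace W (halfOpen τ) γ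

/-! ### Parametrization by arc length -/

/-- The total length of `γ : [0, τ) → ℂ`. -/
def totalLength (τ : ℝ≥0∞) (γ : ℝ → ℂ) : ℝ≥0∞ := eVariationOn γ (halfOpen τ)

/-- The arc-length parametrization, defined on `[0, totalLength τ γ)` and started at `γ(0)`, of
the curve `γ : [0, τ) → ℂ`. -/
def arcLengthParam (τ : ℝ≥0∞) (γ : ℝ → ℂ) : ℝ → ℂ :=
  naturalParameterization γ (halfOpen τ) 0

/-! ### Flow lines -/

/-- `η : I → D` is a flow line of the field `h` on `D`, where `D` is a subset of a space `M` which
is locally identified with the complex plane through `p : M → ℂ` (so that derivatives and arc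
length of `η` are those of `p ∘ η`): it is a `C¹` curve in `D`, parametrized by arc length, with
`η'(s) = exp (i h(η(s)))`. -/
structure IsFlowLineOn {M : Type} [TopologicalSpace M] (p : M → ℂ) (D : Set M) (h : M → ℝ)
    (I : Set ℝ) (η : ℝ → M) : Prop where
  mapsTo : Set.MapsTo η I D
  continuousOn : ContinuousOn η I
  contDiffOn : ContDiffOn ℝ 1 (p ∘ η) I
  unitSpeed : HasUnitSpeedOn (p ∘ η) I
  hasDeriv : ∀ s ∈ I, HasDerivAt (p ∘ η) (Complex.exp (Complex.I * (h (η s) : ℂ))) s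

/-- The points `(r, θ)`, `r > 0`, `θ ∈ ℝ`, of the logarithmic Riemann surface. -/
abbrev LogSurface : Type := {q : ℝ × ℝ // 0 < q.1}

/-- The projection `(r, θ) ↦ z₀ + r exp (i θ)` of the logarithmic Riemann surface centered
at `z₀`; its local inverses are the charts of the surface. -/
def logProj (z₀ : ℂ) (q : LogSurface) : ℂ :=
  z₀ + (q.1.1 : ℂ) * Complex.exp (Complex.I * (q.1.2 : ℂ))

/-- The part of the logarithmic Riemann surface centered at `z₀` above the upper half-plane. -/
def logUpperHalf (z₀ : ℂ) : Set LogSurface := logProj z₀ ⁻¹' upperHalf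

/-- `η'` is the lift, on the time interval `I`, of the curve `η` to the logarithmic Riemann surface
centered at `z₀`, starting at `(r, θ)`. -/
structure IsLogLift (z₀ : ℂ) (r θ : ℝ) (I : Set ℝ) (η : ℝ → ℂ) (η' : ℝ → LogSurface) : Prop where
  continuousOn : ContinuousOn η' I
  initial : (η' 0).1 = (r, θ)
  proj : ∀ s ∈ I, logProj z₀ (η' s) = η s

/-- The field on the upper half-plane for a boundary force point `x₀ ≠ 0`. For `z` in the upper
half-plane the principal arguments below lie in `(0, π)`. -/
def boundaryField (ρ x₀ : ℝ) (z : ℂ) : ℝ :=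
  if 0 < x₀ then
    Real.pi * (1 + ρ / 2) - Complex.arg z - ρ / 2 * Complex.arg (z - (x₀ : ℂ))
  else
    Real.pi - Complex.arg z - ρ / 2 * Complex.arg (z - (x₀ : ℂ))

/-- The field on the logarithmic Riemann surface for an interior force point `z₀`: at
`z = z₀ + r exp (i θ)` it is `π - arg z - (ρ / 4) (arg (z - z₀) + arg (z - conj z₀))`, where
`arg (z - z₀) = θ`, and where the two other arguments are principal ones; they lie in `(0, π)` if
`z` is in the upper half-plane. -/
def interiorField (ρ : ℝ) (z₀ : ℂ) (q : LogSurface) : ℝ :=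
  Real.pi - Complex.arg (logProj z₀ q)
    - ρ / 4 * (q.1.2 + Complex.arg (logProj z₀ q - (starRingEnd ℂ) z₀))

end SLEZero

end

noncomputable section

namespace SLEZero

open Set Filter MeasureTheory

/-! ### Calculus on compact intervals -/

/-! Fix a time `t` and let `β = W'`. The backward flow `u' = -2/u + β(t - r)` started at `iy` ends
at `gₜ⁻¹(Wₜ + iy) - W₀`. Squaring removes the singularity: `(u²)' = -4 + 2βu`. If `|β| < K`, then `1
/ Im u ≤ r^(-1/2) + K` uniformly in `y` (`IsBackward.inv_im_le`). This majorant is integrable, and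
the difference of two squared orbits solves a linear equation with coefficient `2β/(u₁ + u₂)`. So
the limit `tip` as `y → 0` exists, and dominated convergence applies to every integral along it.

Comparing the orbits started at times `t + δ` and `t` in the same way (`IsDrift.tip_shift`) and
dividing by `δ` gives the right derivative of `γ²`, namely `-4 exp ∫ β(t - x)/tip dx`. It is
continuous, so `γ' = -2 exp(∫ β(t - x)/tip dx)/γ` for positive times (`IsDrift.hasDerivAt_trace`).
Moreover `γ²` is locally Lipschitz and `Im γ ≥ c √t`, so increments of `γ` are dominated by those of
`C √t`, which yields continuity and finite length up to time `0`.

Let `A = Z - W`. Along a backward orbit, `u - A(t - ·)` solves a linear equation with coefficient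
`(2/A)/u`, so `∫ (2/A)/tip` is the increment of `log(u - A)` from `-A(t)` to `γ(t) - z₀`; the same
holds for `conj A`. The drift of SLE₀(ρ) is exactly `-(ρ/4)(2/A + 2/conj A)` (`driftFun_eq`). Hence
`arg γ'` is `π - arg γ - (ρ/4)` times the sum of two argument increments, and this is the field. For
`conj A`, and for real `A`, the difference stays in the upper half-plane and principal arguments
suffice. For interior `A` it may wind around `0`, which is why the lift is needed.

Existence of the driving function follows from the time change `dt = |A|² ds`, under which the
equation for `A` is linear and explicitly solvable. -/

theorem hasDerivWithinAt_integral_Icc {E : Type*} [NormedAddCommGroup E] [NormedSpace ℝ E]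
    [CompleteSpace E] {c : ℝ → E} {a b : ℝ} (hc : ContinuousOn c (Icc a b)) {r : ℝ}
    (hr : r ∈ Icc a b) :
    HasDerivWithinAt (fun r => ∫ x in a..r, c x) (c r) (Icc a b) r := by
  have hab : a ≤ b := hr.1.trans hr.2
  -- Extending `c` by its endpoint values makes it continuous on `ℝ`, where the usual fundamental
  -- theorem applies.
  have hext : Continuous (IccExtend hab ((Icc a b).domRestrict c)) :=
    (continuousOn_iff_continuous_domRestrict.1 hc).Icc_extend'
  have heq : ∀ x ∈ Icc a b, IccExtend hab ((Icc a b).domRestrict c) x = c x := fun x hx => by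
    rw [IccExtend_of_mem _ _ hx]; rfl
  have h1 := (hext.integral_hasStrictDerivAt a r).hasDerivAt.hasDerivWithinAt (s := Icc a b)
  rw [heq r hr] at h1
  refine h1.congr (fun x hx => ?_) ?_
  · refine intervalIntegral.integral_congr fun z hz => ?_
    rw [uIcc_of_le hx.1] at hz
    exact (heq z ⟨hz.1, hz.2.trans hx.2⟩).symm
  · refine intervalIntegral.integral_congr fun z hz => ?_
    rw [uIcc_of_le hr.1] at hz
    exact (heq z ⟨hz.1, hz.2.trans hr.2⟩).symm

theorem eq_of_hasDerivWithinAt_zero_Icc {E : Type*} [NormedAddCommGroup E] [NormedSpace ℝ E]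
    {f : ℝ → E} {a b : ℝ} (hf : ∀ r ∈ Icc a b, HasDerivWithinAt f 0 (Icc a b) r) :
    ∀ r ∈ Icc a b, f r = f a :=
  constant_of_has_deriv_right_zero (fun r hr => (hf r hr).continuousWithinAt) fun r hr =>
    (hf r ⟨hr.1, hr.2.le⟩).mono_of_mem_nhdsWithin (Icc_mem_nhdsGE_of_mem hr)

/-- Solutions of the linear equation `f' = c f`. -/
theorem eq_mul_exp_integral {f c : ℝ → ℂ} {a b : ℝ} (hc : ContinuousOn c (Icc a b))
    (hf : ∀ r ∈ Icc a b, HasDerivWithinAt f (c r * f r) (Icc a b) r) {r : ℝ}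
    (hr : r ∈ Icc a b) : f r = f a * Complex.exp (∫ x in a..r, c x) := by
  have h := eq_of_hasDerivWithinAt_zero_Icc
    (f := fun r => f r * Complex.exp (-∫ x in a..r, c x)) (a := a) (b := b) (fun r hr => by
      have h1 := (hf r hr).mul (hasDerivWithinAt_integral_Icc hc hr).neg.cexp
      exact h1.congr_deriv (by ring)) r hr
  simp only [intervalIntegral.integral_same, neg_zero, Complex.exp_zero, mul_one] at h
  rw [← h, mul_assoc, ← Complex.exp_add]
  simp

theorem hasDerivWithinAt_re {f : ℝ → ℂ} {f' : ℂ} {s : Set ℝ} {x : ℝ}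
    (h : HasDerivWithinAt f f' s x) : HasDerivWithinAt (fun t => (f t).re) f'.re s x :=
  (Complex.reCLM.hasFDerivAt.comp_hasDerivWithinAt x h)

theorem hasDerivWithinAt_im {f : ℝ → ℂ} {f' : ℂ} {s : Set ℝ} {x : ℝ}
    (h : HasDerivWithinAt f f' s x) : HasDerivWithinAt (fun t => (f t).im) f'.im s x :=
  (Complex.imCLM.hasFDerivAt.comp_hasDerivWithinAt x h)

theorem monotoneOn_Icc_of_hasDerivWithinAt {f f' : ℝ → ℝ} {a b : ℝ}
    (hf : ∀ r ∈ Icc a b, HasDerivWithinAt f (f' r) (Icc a b) r)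
    (h0 : ∀ r ∈ Icc a b, 0 ≤ f' r) : MonotoneOn f (Icc a b) := by
  refine monotoneOn_of_hasDerivWithinAt_nonneg (convex_Icc a b)
    (fun r hr => (hf r hr).continuousWithinAt) (f' := f') (fun r hr => ?_) fun r hr => ?_
  · exact (hf r (interior_subset hr)).mono interior_subset
  · exact h0 r (interior_subset hr)

theorem image_le_of_hasDerivWithinAt_Icc {f f' : ℝ → ℝ} {a b : ℝ}
    (hf : ∀ r ∈ Icc a b, HasDerivWithinAt f (f' r) (Icc a b) r) {B B' : ℝ → ℝ}
    (ha : f a ≤ B a) (hB : ∀ x, HasDerivAt B (B' x) x)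
    (h : ∀ r ∈ Icc a b, f' r ≤ B' r) : ∀ r ∈ Icc a b, f r ≤ B r := by
  have := monotoneOn_Icc_of_hasDerivWithinAt (f := fun r => B r - f r)
    (fun r hr => (hB r).hasDerivWithinAt.sub (hf r hr)) fun r hr => sub_nonneg.2 (h r hr)
  intro r hr
  have := this ⟨le_rfl, hr.1.trans hr.2⟩ hr hr.1
  simp only at this
  linarith

/-! ### The backward Loewner flow -/

/-- `u` solves on `[0, R]` the backward Loewner equation, centered at its driving function, whose
derivative is `b`. -/
structure IsBackward (b : ℝ → ℝ) (R : ℝ) (u : ℝ → ℂ) : Prop where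
  im_pos : ∀ r ∈ Icc 0 R, 0 < (u r).im
  hasDeriv : ∀ r ∈ Icc 0 R, HasDerivWithinAt u (-2 / u r + (b r : ℂ)) (Icc 0 R) r

/-- The point with the same real part, and with imaginary part at least `y`. -/
def raise (y : ℝ) (z : ℂ) : ℂ := ⟨z.re, max z.im y⟩

theorem norm_raise_sub_le (y : ℝ) (z w : ℂ) : ‖raise y z - raise y w‖ ≤ ‖z - w‖ := by
  rw [Complex.norm_def, Complex.norm_def]
  apply Real.sqrt_le_sqrt
  simp only [Complex.normSq_apply, raise, Complex.sub_re, Complex.sub_im]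
  have h : |max z.im y - max w.im y| ≤ |z.im - w.im| := by
    simpa using abs_max_sub_max_le_max z.im y w.im y
  have := sq_le_sq.2 h
  nlinarith

theorem le_norm_raise (y : ℝ) (z : ℂ) : y ≤ ‖raise y z‖ :=
  (le_max_right _ _).trans ((le_abs_self _).trans (Complex.abs_im_le_norm (raise y z)))

/-- The field `-2/z` is singular at `0`, so it is first evaluated at `raise y z`, which makes it
bounded by `2/y` and Lipschitz with constant `2/y²`. The solution of the truncated equation has
nondecreasing imaginary part, hence never drops below its initial height `y`, and the truncation is
inactive along it. -/
theorem exists_isBackward {b : ℝ → ℝ} {R y : ℝ} (hR : 0 ≤ R) (hy : 0 < y)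
    (hb : ContinuousOn b (Icc 0 R)) : ∃ u : ℝ → ℂ, u 0 = y * Complex.I ∧ IsBackward b R u := by
  obtain ⟨K, hK⟩ := isCompact_Icc.exists_bound_of_continuousOn hb
  have hK0 : 0 ≤ K := (norm_nonneg _).trans (hK 0 ⟨le_rfl, hR⟩)
  set F : ℝ → ℂ → ℂ := fun r z => -2 / raise y z + (b r : ℂ) with hF
  have hr0 : ∀ z, raise y z ≠ 0 := fun z h => by
    have := le_norm_raise y z
    rw [h, norm_zero] at this
    linarith
  have hn : ∀ z, ‖(-2 : ℂ) / raise y z‖ ≤ 2 / y := fun z => by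
    rw [norm_div, norm_neg, Complex.norm_ofNat]
    exact div_le_div_of_nonneg_left (by norm_num) hy (le_norm_raise y z)
  -- The ball has radius (bound on the field) × (length of time), so one application covers all of
  -- `[0, R]`.
  have hpl : IsPicardLindelof F (tmin := 0) (tmax := R) ⟨0, le_rfl, hR⟩ (y * Complex.I)
      (Real.toNNReal ((2 / y + K) * R)) 0 (Real.toNNReal (2 / y + K))
      (Real.toNNReal (2 / y ^ 2)) := by
    refine ⟨fun r _ => ?_, fun z _ => ?_, fun r hr z _ => ?_, ?_⟩
    · refine LipschitzOnWith.of_dist_le_mul fun z _ w _ => ?_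
      rw [Real.coe_toNNReal _ (by positivity), dist_eq_norm, dist_eq_norm]
      have : F r z - F r w = 2 * (raise y z - raise y w) / (raise y z * raise y w) := by
        simp only [hF]
        field_simp [hr0 z, hr0 w]
        ring
      rw [this, norm_div, norm_mul, norm_mul, Complex.norm_ofNat, div_mul_eq_mul_div]
      have h1 := le_norm_raise y z
      have h2 := le_norm_raise y w
      refine div_le_div₀ (by positivity) ?_ (by positivity) (by rw [sq]; gcongr)
      gcongr
      exact norm_raise_sub_le y z w
    · exact continuousOn_const.add (Complex.continuous_ofReal.comp_continuousOn hb)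
    · rw [Real.coe_toNNReal _ (by positivity)]
      refine (norm_add_le _ _).trans (add_le_add (hn z) ?_)
      rw [Complex.norm_real]
      exact hK r hr
    · rw [Real.coe_toNNReal _ (by positivity), Real.coe_toNNReal _ (by positivity)]
      simp [hR]
  obtain ⟨u, hu0, hu⟩ := hpl.exists_eq_forall_mem_Icc_hasDerivWithinAt₀
  have hu0' : u 0 = y * Complex.I := hu0
  have hmono : MonotoneOn (fun r => (u r).im) (Icc 0 R) := by
    refine monotoneOn_Icc_of_hasDerivWithinAt (fun r hr => hasDerivWithinAt_im (hu r hr)) fun r _ => ?_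
    simp only [hF, Complex.add_im, Complex.ofReal_im, add_zero, Complex.div_im, Complex.neg_im,
      Complex.neg_re, Complex.re_ofNat, Complex.im_ofNat]
    have : 0 ≤ (raise y (u r)).im := hy.le.trans (le_max_right _ _)
    have h2 : 0 ≤ Complex.normSq (raise y (u r)) := Complex.normSq_nonneg _
    simp only [neg_zero, zero_mul, zero_div, zero_sub, neg_mul, neg_div, neg_neg]
    positivity
  have him : ∀ r ∈ Icc 0 R, y ≤ (u r).im := fun r hr => by
    have := hmono ⟨le_rfl, hR⟩ hr hr.1
    simpa [hu0'] using this
  refine ⟨u, hu0', fun r hr => hy.trans_le (him r hr), fun r hr => ?_⟩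
  have h : raise y (u r) = u r := by
    apply Complex.ext <;> simp [raise, him r hr]
  have := hu r hr
  simpa only [hF, h] using this

namespace IsBackward

variable {b : ℝ → ℝ} {R y K : ℝ} {u : ℝ → ℂ}

theorem ne_zero (h : IsBackward b R u) {r : ℝ} (hr : r ∈ Icc 0 R) : u r ≠ 0 := fun h0 => by
  have := h.im_pos r hr
  simp [h0] at this

theorem continuousOn (h : IsBackward b R u) : ContinuousOn u (Icc 0 R) :=
  fun r hr => (h.hasDeriv r hr).continuousWithinAt

theorem hasDeriv_re (h : IsBackward b R u) {r : ℝ} (hr : r ∈ Icc 0 R) :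
    HasDerivWithinAt (fun r => (u r).re) (-2 * (u r).re / Complex.normSq (u r) + b r)
      (Icc 0 R) r := by
  have := hasDerivWithinAt_re (h.hasDeriv r hr)
  simpa [Complex.div_re] using this

theorem hasDeriv_im (h : IsBackward b R u) {r : ℝ} (hr : r ∈ Icc 0 R) :
    HasDerivWithinAt (fun r => (u r).im) (2 * (u r).im / Complex.normSq (u r)) (Icc 0 R) r := by
  have := hasDerivWithinAt_im (h.hasDeriv r hr)
  simpa [Complex.div_im, neg_div] using this

/-- The equation for the square has no pole; the estimates near `r = 0` rest on it. -/
theorem hasDeriv_sq (h : IsBackward b R u) {r : ℝ} (hr : r ∈ Icc 0 R) :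
    HasDerivWithinAt (fun r => u r ^ 2) (-4 + 2 * (b r : ℂ) * u r) (Icc 0 R) r := by
  refine ((h.hasDeriv r hr).pow 2).congr_deriv ?_
  have := h.ne_zero hr
  field_simp
  ring

theorem normSq_pos (h : IsBackward b R u) {r : ℝ} (hr : r ∈ Icc 0 R) :
    0 < Complex.normSq (u r) := Complex.normSq_pos.2 (h.ne_zero hr)

theorem monotoneOn_im (h : IsBackward b R u) : MonotoneOn (fun r => (u r).im) (Icc 0 R) :=
  monotoneOn_Icc_of_hasDerivWithinAt (fun _ hr => h.hasDeriv_im hr) fun r hr =>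
    div_nonneg (mul_nonneg (by norm_num) (h.im_pos r hr).le) (h.normSq_pos hr).le

/-- Barrier argument: where `Re u = K r ≥ 0`, the term `-2/u` pushes towards the imaginary axis, so
the slope of `Re u` is at most `b < K` there. The strict bound on the drift is what forbids a
crossing. -/
theorem re_le (h : IsBackward b R u) (h0 : (u 0).re = 0) (hb : ∀ r ∈ Icc 0 R, |b r| < K)
    {r : ℝ} (hr : r ∈ Icc 0 R) : (u r).re ≤ K * r := by
  refine image_le_of_deriv_right_lt_deriv_boundary (f := fun r => (u r).re) (B := fun r => K * r)
    (B' := fun _ => K) (f' := fun r => -2 * (u r).re / Complex.normSq (u r) + b r)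
    (fun r hr => (h.hasDeriv_re hr).continuousWithinAt)
    (fun r hr => (h.hasDeriv_re ⟨hr.1, hr.2.le⟩).mono_of_mem_nhdsWithin
      (Icc_mem_nhdsGE_of_mem hr)) (by simp [h0])
    (fun x => by simpa using (hasDerivAt_id x).const_mul K) ?_ hr
  intro x hx hxe
  have hx' : x ∈ Icc 0 R := ⟨hx.1, hx.2.le⟩
  have hK := hb x hx'
  have hK0 : 0 ≤ K := (abs_nonneg _).trans hK.le
  have : 0 ≤ (u x).re := by
    have : (u x).re = K * x := hxe
    rw [this]; exact mul_nonneg hK0 hx.1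
  have h1 : -2 * (u x).re / Complex.normSq (u x) ≤ 0 :=
    div_nonpos_of_nonpos_of_nonneg (by linarith) (h.normSq_pos hx').le
  linarith [le_abs_self (b x)]

/-- The reflection of a backward orbit in the imaginary axis. -/
theorem reflect (h : IsBackward b R u) :
    IsBackward (fun r => -b r) R fun r => -(starRingEnd ℂ) (u r) := by
  refine ⟨fun r hr => by simpa using h.im_pos r hr, fun r hr => ?_⟩
  refine (Complex.conjCLE.toContinuousLinearMap.hasFDerivAt.comp_hasDerivWithinAt r
    (h.hasDeriv r hr)).neg.congr_deriv ?_
  simp [neg_div, div_neg, map_ofNat, add_comm]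

theorem abs_re_le (h : IsBackward b R u) (h0 : (u 0).re = 0) (hb : ∀ r ∈ Icc 0 R, |b r| < K)
    {r : ℝ} (hr : r ∈ Icc 0 R) : |(u r).re| ≤ K * r := by
  refine abs_le'.2 ⟨h.re_le h0 hb hr, ?_⟩
  have := h.reflect.re_le (K := K) (by simp [h0]) (fun r hr => by simpa using hb r hr) hr
  simpa using this

theorem im_sq_le (h : IsBackward b R u) {r : ℝ} (hr : r ∈ Icc 0 R) :
    (u r).im ^ 2 ≤ (u 0).im ^ 2 + 4 * r := by
  refine image_le_of_hasDerivWithinAt_Icc (f := fun r => (u r).im ^ 2)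
    (B := fun r => (u 0).im ^ 2 + 4 * r) (B' := fun _ => 4)
    (fun r hr => (h.hasDeriv_im hr).pow 2) (by simp)
    (fun x => (((hasDerivAt_id x).const_mul (4 : ℝ)).const_add _).congr_deriv (by simp)) (fun r hr => ?_) r hr
  have h1 := h.normSq_pos hr
  have h2 : 2 * (u r).im * (2 * (u r).im / Complex.normSq (u r)) =
      4 * ((u r).im * (u r).im) / Complex.normSq (u r) := by ring
  simp only [Nat.cast_ofNat, Nat.add_one_sub_one, pow_one]
  rw [h2, div_le_iff₀ h1, Complex.normSq_apply]
  nlinarith [mul_self_nonneg (u r).re]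

theorem norm_le (h : IsBackward b R u) (h0 : u 0 = y * Complex.I) (hy : 0 ≤ y)
    (hb : ∀ r ∈ Icc 0 R, |b r| < K) {r : ℝ} (hr : r ∈ Icc 0 R) :
    ‖u r‖ ≤ K * r + (y + 2 * √r) := by
  refine (Complex.norm_le_abs_re_add_abs_im _).trans
    (add_le_add (h.abs_re_le (by simp [h0]) hb hr) ?_)
  have h1 := h.im_sq_le hr
  simp only [h0, Complex.mul_im, Complex.ofReal_re, Complex.I_im, mul_one, Complex.ofReal_im,
    Complex.I_re, mul_zero, add_zero] at h1
  rw [abs_of_pos (h.im_pos r hr)]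
  refine le_of_sq_le_sq ?_ (by positivity)
  have := Real.sq_sqrt hr.1
  nlinarith [mul_nonneg hy (Real.sqrt_nonneg r)]

/-- `Im² ≥ -Re(u²)`, and `Re(u²)` has derivative `-4 + 2 b Re u ≤ -4 + 2K² r` by the bound on the
real part. -/
theorem le_im_sq (h : IsBackward b R u) (h0 : u 0 = y * Complex.I)
    (hb : ∀ r ∈ Icc 0 R, |b r| < K) {r : ℝ} (hr : r ∈ Icc 0 R) :
    4 * r - K ^ 2 * r ^ 2 ≤ (u r).im ^ 2 := by
  have key := image_le_of_hasDerivWithinAt_Icc (f := fun r => (u r ^ 2).re)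
    (B := fun r => -y ^ 2 - 4 * r + K ^ 2 * r ^ 2) (B' := fun r => -4 + K ^ 2 * (2 * r))
    (fun r hr => hasDerivWithinAt_re (h.hasDeriv_sq hr)) (by simp [h0, sq])
    (fun x => ((((hasDerivAt_id x).const_mul (4 : ℝ)).const_sub (-y ^ 2)).add
        (((hasDerivAt_id x).pow 2).const_mul (K ^ 2))).congr_deriv (by simp)) (fun r hr => ?_) r hr
  · have h1 : (u r ^ 2).re = (u r).re ^ 2 - (u r).im ^ 2 := by simp [sq]
    simp only [h1] at key
    nlinarith [sq_nonneg (u r).re, sq_nonneg y]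
  · have h1 := h.abs_re_le (by simp [h0]) hb hr
    have h2 := (hb r hr).le
    have h3 : |b r| * |(u r).re| ≤ K * (K * r) := by
      have : 0 ≤ K := (abs_nonneg _).trans h2
      gcongr
    have h4 : b r * (u r).re ≤ K * (K * r) := by
      refine (le_abs_self _).trans ?_
      rwa [abs_mul]
    have h5 : (-4 + 2 * (b r : ℂ) * u r).re = -4 + 2 * (b r * (u r).re) := by
      simp [mul_assoc]
    rw [h5]
    nlinarith

/-- This bound does not depend on the starting height and is integrable at `r = 0`; it supplies the
majorant for all limits below. -/
theorem inv_im_le (h : IsBackward b R u) (h0 : u 0 = y * Complex.I)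
    (hb : ∀ r ∈ Icc 0 R, |b r| < K) {r : ℝ} (hr : r ∈ Ioc 0 R) :
    ((u r).im)⁻¹ ≤ (√r)⁻¹ + K := by
  have hr' : r ∈ Icc 0 R := ⟨hr.1.le, hr.2⟩
  have hK : 0 < K := (abs_nonneg _).trans_lt (hb r hr')
  have hs : 0 < √r := Real.sqrt_pos.2 hr.1
  -- Up to `r = 3/K²`, `le_im_sq` gives `Im² ≥ r`. Beyond it, monotonicity gives `Im ≥ 1/K`, because
  -- `le_im_sq` at `3/K²` reads `Im² ≥ 3/K²`.
  by_cases hc : K ^ 2 * r ≤ 3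
  · have h1 := h.le_im_sq h0 hb hr'
    have h2 : √r ≤ (u r).im := by
      refine Real.sqrt_le_iff.2 ⟨(h.im_pos r hr').le, ?_⟩
      nlinarith [hr.1]
    have := inv_anti₀ hs h2
    linarith
  · have hr0 : 3 / K ^ 2 ∈ Icc 0 R := ⟨by positivity, by
      refine le_trans ?_ hr.2
      rw [div_le_iff₀ (by positivity)]
      linarith⟩
    have h1 := h.le_im_sq h0 hb hr0
    have h2 : (1 / K) ≤ (u (3 / K ^ 2)).im := by
      refine le_of_sq_le_sq ?_ (h.im_pos _ hr0).le
      refine le_trans ?_ h1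
      field_simp
      norm_num
    have h3 : (u (3 / K ^ 2)).im ≤ (u r).im := by
      refine h.monotoneOn_im hr0 hr' ?_
      rw [div_le_iff₀ (by positivity)]
      linarith
    have := inv_anti₀ (by positivity) (h2.trans h3)
    rw [one_div, inv_inv] at this
    have : 0 < (√r)⁻¹ := by positivity
    linarith

theorem norm_sq_sub_le (h : IsBackward b R u) (hb : ∀ r ∈ Icc 0 R, |b r| < K) {M r₁ r₂ : ℝ}
    (h1 : 0 ≤ r₁) (h12 : r₁ ≤ r₂) (h2 : r₂ ≤ R) (hM : ∀ r ∈ Icc r₁ r₂, ‖u r‖ ≤ M) :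
    ‖u r₂ ^ 2 - u r₁ ^ 2 + 4 * (r₂ - r₁)‖ ≤ 2 * K * M * (r₂ - r₁) := by
  have hsub : Icc r₁ r₂ ⊆ Icc 0 R := Icc_subset_Icc h1 h2
  have := norm_image_sub_le_of_norm_deriv_le_segment' (f := fun r => u r ^ 2 + 4 * (r : ℂ))
    (f' := fun r => 2 * (b r : ℂ) * u r) (C := 2 * K * M) (a := r₁) (b := r₂) (fun r hr => by
      have h1 := ((h.hasDeriv_sq (hsub hr)).mono hsub).add
        ((Complex.ofRealCLM.hasDerivAt (x := r)).const_mul (4 : ℂ)).hasDerivWithinAt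
      exact h1.congr_deriv (by simp)) (fun r hr => ?_) r₂ ⟨h12, le_rfl⟩
  · refine (le_of_eq ?_).trans this
    congr 1
    ring
  · have hr' : r ∈ Icc r₁ r₂ := ⟨hr.1, hr.2.le⟩
    rw [norm_mul, norm_mul, Complex.norm_ofNat, Complex.norm_real, Real.norm_eq_abs]
    have h3 := (hb r (hsub hr')).le
    have h4 := hM r hr'
    have h5 : 0 ≤ K := (abs_nonneg _).trans h3
    gcongr

end IsBackward

/-! ### Comparison of backward orbits -/

theorem intervalIntegrable_inv_sqrt_add (a b K : ℝ) :
    IntervalIntegrable (fun x : ℝ => (√x)⁻¹ + K) volume a b := by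
  refine IntervalIntegrable.add ?_ intervalIntegrable_const
  have h0 : ∀ c : ℝ, IntervalIntegrable (fun x : ℝ => (√x)⁻¹) volume 0 c := fun c => by
    rcases le_total 0 c with hc | hc
    · refine (intervalIntegral.intervalIntegrable_rpow' (a := 0) (b := c) (r := -(1 / 2))
        (by norm_num)).congr fun x hx => ?_
      rw [uIoc_of_le hc] at hx
      simp only [Real.rpow_neg hx.1.le, Real.sqrt_eq_rpow]
    -- For negative `x` both `√x` and its inverse take the default value `0`.
    · refine IntervalIntegrable.congr (f := fun _ => (0 : ℝ)) (fun x hx => ?_)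
        intervalIntegrable_const
      rw [uIoc_of_ge hc] at hx
      simp [Real.sqrt_eq_zero_of_nonpos hx.2]
  exact (h0 a).symm.trans (h0 b)

theorem integral_inv_sqrt_add {R : ℝ} (hR : 0 ≤ R) (K : ℝ) :
    ∫ x in 0..R, ((√x)⁻¹ + K) = 2 * √R + K * R := by
  have := intervalIntegral.integral_eq_sub_of_hasDerivAt_of_le (a := 0) (b := R)
    (f := fun x => 2 * √x + K * x) (f' := fun x => (√x)⁻¹ + K) hR
    (by fun_prop) (fun x hx => by
      have h1 := ((Real.hasDerivAt_sqrt hx.1.ne').const_mul 2).add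
        ((hasDerivAt_id x).const_mul K)
      have h2 : 0 < √x := Real.sqrt_pos.2 hx.1
      exact h1.congr_deriv (by field_simp)) (intervalIntegrable_inv_sqrt_add 0 R K)
  simpa using this

/-- Dominated convergence with the majorant `C (x ^ (-1/2) + K)`. -/
theorem tendsto_integral_of_norm_le_inv_sqrt {ι : Type*} {l : Filter ι} [l.IsCountablyGenerated]
    {F : ι → ℝ → ℂ} {F₀ : ℝ → ℂ} {C K R : ℝ} (hR : 0 ≤ R)
    (hm : ∀ᶠ i in l, AEStronglyMeasurable (F i) (volume.restrict (Ioc 0 R)))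
    (hb : ∀ᶠ i in l, ∀ x ∈ Ioc 0 R, ‖F i x‖ ≤ C * ((√x)⁻¹ + K))
    (hl : ∀ᵐ x, x ∈ Ioc 0 R → Tendsto (fun i => F i x) l (𝓝 (F₀ x))) :
    Tendsto (fun i => ∫ x in 0..R, F i x) l (𝓝 (∫ x in 0..R, F₀ x)) := by
  refine intervalIntegral.tendsto_integral_filter_of_dominated_convergence
    (fun x => C * ((√x)⁻¹ + K)) ?_ ?_ ((intervalIntegrable_inv_sqrt_add 0 R K).const_mul C) ?_
  · simpa only [uIoc_of_le hR] using hm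
  · filter_upwards [hb] with i hi
    simpa only [uIoc_of_le hR] using Eventually.of_forall hi
  · simpa only [uIoc_of_le hR] using hl

/-- In the upper half-plane `z + w` stays at height at least `Im w`, so dividing `z² - w²` by it
converts control of squares into control of points. -/
theorem norm_sub_le_of_im_pos {z w : ℂ} (hz : 0 < z.im) (hw : 0 < w.im) :
    ‖z - w‖ ≤ ‖z ^ 2 - w ^ 2‖ * (w.im)⁻¹ := by
  have h1 : z ^ 2 - w ^ 2 = (z - w) * (z + w) := by ring
  have h2 : w.im ≤ ‖z + w‖ := by
    refine le_trans ?_ (Complex.abs_im_le_norm _)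
    rw [Complex.add_im, abs_of_pos (by linarith)]
    linarith
  rw [h1, norm_mul, ← div_eq_mul_inv, le_div_iff₀ hw]
  gcongr

theorem norm_inv_add_le {z w : ℂ} (hz : 0 < z.im) (hw : 0 < w.im) : ‖z + w‖⁻¹ ≤ (w.im)⁻¹ := by
  refine inv_anti₀ hw (le_trans ?_ (Complex.abs_im_le_norm _))
  rw [Complex.add_im, abs_of_pos (by linarith)]
  linarith

theorem tendsto_of_sq_tendsto {ι : Type*} {l : Filter ι} {f : ι → ℂ} {w : ℂ}
    (hf : ∀ᶠ i in l, 0 < (f i).im) (hw : 0 < w.im)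
    (h : Tendsto (fun i => f i ^ 2) l (𝓝 (w ^ 2))) : Tendsto f l (𝓝 w) := by
  rw [tendsto_iff_norm_sub_tendsto_zero] at h ⊢
  refine squeeze_zero' (Eventually.of_forall fun _ => norm_nonneg _)
    (hf.mono fun i hi => norm_sub_le_of_im_pos hi hw) ?_
  simpa using h.mul_const (w.im)⁻¹

/-- The constant in the comparison of two backward orbits. -/
def compConst (K R : ℝ) : ℝ := Real.exp (2 * K * (2 * √R + K * R))

theorem compConst_pos (K R : ℝ) : 0 < compConst K R := Real.exp_pos _

theorem compConst_mono {K R S : ℝ} (hK : 0 ≤ K) (h : R ≤ S) : compConst K R ≤ compConst K S := by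
  unfold compConst
  gcongr

namespace IsBackward

variable {b : ℝ → ℝ} {R y K : ℝ} {u u₁ u₂ : ℝ → ℂ}

theorem add_ne_zero (h1 : IsBackward b R u₁) (h2 : IsBackward b R u₂) {r : ℝ}
    (hr : r ∈ Icc 0 R) : u₁ r + u₂ r ≠ 0 := fun h => by
  have := congrArg Complex.im h
  simp only [Complex.add_im, Complex.zero_im] at this
  linarith [h1.im_pos r hr, h2.im_pos r hr]

/-- In the difference of the equations for the squares the constant `-4` cancels, leaving `2b(u₁ -
u₂) = (2b/(u₁ + u₂)) (u₁² - u₂²)`. -/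
theorem sq_sub_sq (h1 : IsBackward b R u₁) (h2 : IsBackward b R u₂)
    (hb : ContinuousOn b (Icc 0 R)) {r : ℝ} (hr : r ∈ Icc 0 R) :
    u₁ r ^ 2 - u₂ r ^ 2 =
      (u₁ 0 ^ 2 - u₂ 0 ^ 2) * Complex.exp (∫ x in 0..r, 2 * (b x : ℂ) / (u₁ x + u₂ x)) := by
  refine eq_mul_exp_integral (f := fun r => u₁ r ^ 2 - u₂ r ^ 2) (b := R) ?_ (fun r hr => ?_) hr
  · exact ContinuousOn.div (continuousOn_const.mul (Complex.continuous_ofReal.comp_continuousOn hb))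
      (h1.continuousOn.add h2.continuousOn) fun r hr => h1.add_ne_zero h2 hr
  · refine ((h1.hasDeriv_sq hr).sub (h2.hasDeriv_sq hr)).congr_deriv ?_
    have := h1.add_ne_zero h2 hr
    field_simp
    ring

theorem norm_sq_sub_sq_le (h1 : IsBackward b R u₁) (h2 : IsBackward b R u₂)
    (hb : ContinuousOn b (Icc 0 R)) (hK : ∀ r ∈ Icc 0 R, |b r| < K)
    (hinv : ∀ r ∈ Ioc 0 R, ((u₂ r).im)⁻¹ ≤ (√r)⁻¹ + K) {r : ℝ} (hr : r ∈ Icc 0 R) :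
    ‖u₁ r ^ 2 - u₂ r ^ 2‖ ≤ ‖u₁ 0 ^ 2 - u₂ 0 ^ 2‖ * compConst K R := by
  have hK0 : 0 ≤ K := (abs_nonneg _).trans (hK r hr).le
  rw [h1.sq_sub_sq h2 hb hr, norm_mul]
  refine mul_le_mul_of_nonneg_left ?_ (norm_nonneg _)
  refine (Complex.norm_exp_le_exp_norm _).trans ?_
  refine le_trans ?_ (compConst_mono hK0 hr.2)
  refine Real.exp_le_exp.2 ?_
  have := intervalIntegral.norm_integral_le_of_norm_le (μ := volume) (a := 0) (b := r)
    (f := fun x => 2 * (b x : ℂ) / (u₁ x + u₂ x)) (g := fun x => 2 * K * ((√x)⁻¹ + K)) hr.1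
    (Eventually.of_forall fun x hx => ?_)
    ((intervalIntegrable_inv_sqrt_add 0 r K).const_mul _)
  · refine this.trans_eq ?_
    rw [intervalIntegral.integral_const_mul, integral_inv_sqrt_add hr.1]
  · have hx1 : x ∈ Ioc 0 R := ⟨hx.1, hx.2.trans hr.2⟩
    have hx2 : x ∈ Icc 0 R := ⟨hx1.1.le, hx1.2⟩
    rw [norm_div, norm_mul, Complex.norm_ofNat, Complex.norm_real, Real.norm_eq_abs,
      div_eq_mul_inv]
    gcongr
    · exact (hK x hx2).le
    · exact (norm_inv_add_le (h1.im_pos x hx2) (h2.im_pos x hx2)).trans (hinv x hx1)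

/-- After running for `δ`, an orbit from time `t + δ` sees the same drift as a fresh orbit from time
`t`. This makes orbits from different times comparable. -/
theorem shift {β : ℝ → ℝ} {t δ : ℝ} (hδ : 0 ≤ δ)
    (h : IsBackward (fun r => β (t + δ - r)) (t + δ) u) :
    IsBackward (fun r => β (t - r)) t fun r => u (δ + r) := by
  have hm : MapsTo (fun r => δ + r) (Icc 0 t) (Icc 0 (t + δ)) :=
    fun r hr => ⟨add_nonneg hδ hr.1, by linarith [hr.2]⟩
  refine ⟨fun r hr => h.im_pos _ (hm hr), fun r hr => ?_⟩
  have h1 := (h.hasDeriv (δ + r) (hm hr)).scomp r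
    (((hasDerivAt_id r).const_add δ).hasDerivWithinAt) hm
  refine h1.congr_deriv ?_
  have : t + δ - (δ + r) = t - r := by ring
  simp [this]

end IsBackward

/-- `β` is continuous on `[0, T]` and bounded there by `K`. -/
structure IsDrift (β : ℝ → ℝ) (T K : ℝ) : Prop where
  continuousOn : ContinuousOn β (Icc 0 T)
  abs_lt : ∀ s ∈ Icc 0 T, |β s| < K

open Classical in
/-- The backward orbit started at `y i`, for the drift `β` run backwards from time `t`. -/
def backSol (β : ℝ → ℝ) (t y : ℝ) : ℝ → ℂ :=
  if h : ∃ u : ℝ → ℂ, u 0 = y * Complex.I ∧ IsBackward (fun r => β (t - r)) t u then h.choose else 0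

/-- The limit of the backward orbits started at `y i` as `y → 0+`. -/
def tip (β : ℝ → ℝ) (t r : ℝ) : ℂ := limUnder (𝓝[>] 0) fun y => backSol β t y r

/-! ### Limits of backward orbits as the starting height tends to zero -/

namespace IsDrift

variable {β : ℝ → ℝ} {T K t r y : ℝ}

theorem mapsTo_sub (ht : t ≤ T) : MapsTo (fun r => t - r) (Icc 0 t) (Icc 0 T) :=
  fun _ hr => ⟨sub_nonneg.2 hr.2, by linarith [hr.1]⟩

theorem continuousOn_comp_sub {E : Type*} [TopologicalSpace E] {k : ℝ → E}
    (hk : ContinuousOn k (Icc 0 T)) (ht : t ≤ T) :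
    ContinuousOn (fun r => k (t - r)) (Icc 0 t) :=
  hk.comp (by fun_prop) (mapsTo_sub ht)

theorem abs_sub_lt (h : IsDrift β T K) (ht : t ≤ T) : ∀ r ∈ Icc 0 t, |β (t - r)| < K :=
  fun _ hr => h.abs_lt _ (mapsTo_sub ht hr)

theorem backSol_spec (h : IsDrift β T K) (h0 : 0 ≤ t) (ht : t ≤ T) (hy : 0 < y) :
    backSol β t y 0 = y * Complex.I ∧ IsBackward (fun r => β (t - r)) t (backSol β t y) := by
  have hex := exists_isBackward h0 hy (continuousOn_comp_sub h.continuousOn ht)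
  rw [backSol, dif_pos hex]
  exact hex.choose_spec

theorem K_pos (h : IsDrift β T K) (h0 : 0 ≤ T) : 0 < K :=
  (abs_nonneg _).trans_lt (h.abs_lt 0 ⟨le_rfl, h0⟩)

theorem backSol_inv_im_le (h : IsDrift β T K) (ht : t ≤ T) (hy : 0 < y) (hr : r ∈ Ioc 0 t) :
    ((backSol β t y r).im)⁻¹ ≤ (√r)⁻¹ + K := by
  have hs := h.backSol_spec (hr.1.le.trans hr.2) ht hy
  exact hs.2.inv_im_le hs.1 (h.abs_sub_lt ht) hr

theorem norm_backSol_sub_le (h : IsDrift β T K) (ht : t ≤ T) (hr : r ∈ Ioc 0 t) {y z : ℝ}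
    (hy : 0 < y) (hz : 0 < z) : ‖backSol β t y r - backSol β t z r‖ ≤
      |y ^ 2 - z ^ 2| * compConst K t * ((√r)⁻¹ + K) := by
  have h0 := hr.1.le.trans hr.2
  have hr' : r ∈ Icc 0 t := ⟨hr.1.le, hr.2⟩
  have h1 := h.backSol_spec h0 ht hy
  have h2 := h.backSol_spec h0 ht hz
  have h3 := h1.2.norm_sq_sub_sq_le h2.2 (continuousOn_comp_sub h.continuousOn ht)
    (h.abs_sub_lt ht) (fun r hr => h.backSol_inv_im_le ht hz hr) hr'
  have h4 : ‖backSol β t y 0 ^ 2 - backSol β t z 0 ^ 2‖ = |y ^ 2 - z ^ 2| := by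
    rw [h1.1, h2.1, mul_pow, mul_pow, Complex.I_sq, ← Real.norm_eq_abs, ← Complex.norm_real,
      ← norm_neg]
    congr 1
    push_cast
    ring
  rw [h4] at h3
  refine (norm_sub_le_of_im_pos (h1.2.im_pos r hr') (h2.2.im_pos r hr')).trans ?_
  have := compConst_pos K t
  have := h.backSol_inv_im_le ht hz hr
  have := inv_pos.2 (h2.2.im_pos r hr')
  gcongr

theorem tendsto_tip (h : IsDrift β T K) (ht : t ≤ T) (hr : r ∈ Icc 0 t) :
    Tendsto (fun y => backSol β t y r) (𝓝[>] 0) (𝓝 (tip β t r)) := by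
  refine tendsto_nhds_limUnder ?_
  have h0 := hr.1.trans hr.2
  rcases hr.1.eq_or_lt with rfl | hr0
  · refine ⟨0, ?_⟩
    have : Tendsto (fun y : ℝ => (y : ℂ) * Complex.I) (𝓝[>] 0) (𝓝 0) := by
      have : Continuous fun y : ℝ => (y : ℂ) * Complex.I := by fun_prop
      simpa using (this.tendsto 0).mono_left nhdsWithin_le_nhds
    refine this.congr' ?_
    filter_upwards [self_mem_nhdsWithin] with y hy
    exact (h.backSol_spec h0 ht hy).1.symm
  · have hr' : r ∈ Ioc 0 t := ⟨hr0, hr.2⟩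
    set C := compConst K t * ((√r)⁻¹ + K) with hC
    have hC0 : 0 < C := mul_pos (compConst_pos _ _)
      (by have := h.K_pos (h0.trans ht); positivity)
    rw [← cauchy_map_iff_exists_tendsto, Metric.cauchy_iff]
    refine ⟨inferInstance, fun ε hε => ?_⟩
    -- The comparison is in terms of `|y² - z²|`, so heights with squares below `ε/C` suffice.
    refine ⟨(fun y => backSol β t y r) '' Ioo 0 (√(ε / C)),
      image_mem_map (Ioo_mem_nhdsGT (by positivity)), ?_⟩
    rintro _ ⟨y, hy, rfl⟩ _ ⟨z, hz, rfl⟩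
    rw [dist_eq_norm]
    refine (h.norm_backSol_sub_le ht hr' hy.1 hz.1).trans_lt ?_
    have h1 := (Real.lt_sqrt hy.1.le).1 hy.2
    have h2 := (Real.lt_sqrt hz.1.le).1 hz.2
    have h3 : |y ^ 2 - z ^ 2| < ε / C := _root_.abs_lt.2 ⟨by nlinarith [sq_nonneg y], by
      nlinarith [sq_nonneg z]⟩
    rw [mul_assoc, ← hC]
    exact (lt_div_iff₀ hC0).1 h3

theorem tip_zero (h : IsDrift β T K) (h0 : 0 ≤ t) (ht : t ≤ T) : tip β t 0 = 0 := by
  refine tendsto_nhds_unique (h.tendsto_tip ht ⟨le_rfl, h0⟩) ?_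
  have : Tendsto (fun y : ℝ => (y : ℂ) * Complex.I) (𝓝[>] 0) (𝓝 0) := by
    have : Continuous fun y : ℝ => (y : ℂ) * Complex.I := by fun_prop
    simpa using (this.tendsto 0).mono_left nhdsWithin_le_nhds
  refine this.congr' ?_
  filter_upwards [self_mem_nhdsWithin] with y hy
  exact (h.backSol_spec h0 ht hy).1.symm

theorem le_im_tip (h : IsDrift β T K) (ht : t ≤ T) (hr : r ∈ Ioc 0 t) :
    ((√r)⁻¹ + K)⁻¹ ≤ (tip β t r).im := by
  have h0 := hr.1.le.trans hr.2
  have hr' : r ∈ Icc 0 t := ⟨hr.1.le, hr.2⟩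
  refine ge_of_tendsto ((Complex.continuous_im.tendsto _).comp (h.tendsto_tip ht hr')) ?_
  filter_upwards [self_mem_nhdsWithin] with y hy
  have := (h.backSol_spec h0 ht hy).2.im_pos r hr'
  exact inv_le_of_inv_le₀ this (h.backSol_inv_im_le ht hy hr)

theorem im_tip_pos (h : IsDrift β T K) (ht : t ≤ T) (hr : r ∈ Ioc 0 t) : 0 < (tip β t r).im := by
  have := h.K_pos (hr.1.le.trans (hr.2.trans ht))
  have := Real.sqrt_pos.2 hr.1
  exact lt_of_lt_of_le (by positivity) (h.le_im_tip ht hr)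

theorem inv_im_tip_le (h : IsDrift β T K) (ht : t ≤ T) (hr : r ∈ Ioc 0 t) :
    ((tip β t r).im)⁻¹ ≤ (√r)⁻¹ + K := by
  have := h.K_pos (hr.1.le.trans (hr.2.trans ht))
  have := Real.sqrt_pos.2 hr.1
  exact inv_le_of_inv_le₀ (by positivity) (h.le_im_tip ht hr)

theorem norm_inv_tip_le (h : IsDrift β T K) (ht : t ≤ T) (hr : r ∈ Ioc 0 t) :
    ‖tip β t r‖⁻¹ ≤ (√r)⁻¹ + K :=
  (inv_anti₀ (h.im_tip_pos ht hr) ((le_abs_self _).trans (Complex.abs_im_le_norm _))).trans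
    (h.inv_im_tip_le ht hr)

theorem tip_ne_zero (h : IsDrift β T K) (ht : t ≤ T) (hr : r ∈ Ioc 0 t) : tip β t r ≠ 0 :=
  fun h0 => by simpa [h0] using h.im_tip_pos ht hr

/-- A quantitative form of `tip² ≈ -4r`: for `r₁ = 0` the error is `o(r₂)`, which produces the
factor `-4` in the derivative of the squared trace. -/
theorem norm_tip_sq_sub_le (h : IsDrift β T K) (ht : t ≤ T) {r₁ r₂ : ℝ} (h1 : 0 ≤ r₁)
    (h12 : r₁ ≤ r₂) (h2 : r₂ ≤ t) :
    ‖tip β t r₂ ^ 2 - tip β t r₁ ^ 2 + 4 * (r₂ - r₁)‖ ≤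
      2 * K * (K * r₂ + 2 * √r₂) * (r₂ - r₁) := by
  have hlim : Tendsto (fun y => 2 * K * (K * r₂ + (y + 2 * √r₂)) * (r₂ - r₁)) (𝓝[>] 0)
      (𝓝 (2 * K * (K * r₂ + 2 * √r₂) * (r₂ - r₁))) := by
    have : Continuous fun y => 2 * K * (K * r₂ + (y + 2 * √r₂)) * (r₂ - r₁) := by fun_prop
    simpa using (this.tendsto 0).mono_left nhdsWithin_le_nhds
  refine le_of_tendsto_of_tendsto ((((h.tendsto_tip ht ⟨h1.trans h12, h2⟩).pow 2).sub
    ((h.tendsto_tip ht ⟨h1, h12.trans h2⟩).pow 2)).add_const _).norm hlim ?_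
  filter_upwards [self_mem_nhdsWithin] with y hy
  have hs := h.backSol_spec (h1.trans (h12.trans h2)) ht hy
  refine hs.2.norm_sq_sub_le (h.abs_sub_lt ht) h1 h12 h2 fun r hr => ?_
  have hK := h.K_pos ((h1.trans (h12.trans h2)).trans ht)
  refine (hs.2.norm_le hs.1 (le_of_lt hy) (h.abs_sub_lt ht)
    ⟨h1.trans hr.1, hr.2.trans h2⟩).trans ?_
  have := hr.2
  gcongr

/-- A Lipschitz constant for the squares of the tips. -/
def lipConst (K T : ℝ) : ℝ := 4 + 2 * K * (K * T + 2 * √T)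

theorem lipConst_pos (h : IsDrift β T K) (h0 : 0 ≤ T) : 0 < lipConst K T := by
  have := h.K_pos h0
  unfold lipConst
  positivity

theorem norm_tip_sq_sub_le' (h : IsDrift β T K) (ht : t ≤ T) {r₁ r₂ : ℝ} (h1 : 0 ≤ r₁)
    (h12 : r₁ ≤ r₂) (h2 : r₂ ≤ t) :
    ‖tip β t r₂ ^ 2 - tip β t r₁ ^ 2‖ ≤ lipConst K T * (r₂ - r₁) := by
  have h3 := h.norm_tip_sq_sub_le ht h1 h12 h2
  have hK := h.K_pos ((h1.trans (h12.trans h2)).trans ht)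
  have h4 : ‖(4 * (r₂ - r₁) : ℂ)‖ = 4 * (r₂ - r₁) := by
    rw [← Complex.ofReal_sub, norm_mul, Complex.norm_real, Real.norm_of_nonneg (sub_nonneg.2 h12)]
    simp
  have h5 : 2 * K * (K * r₂ + 2 * √r₂) * (r₂ - r₁) ≤ 2 * K * (K * T + 2 * √T) * (r₂ - r₁) := by
    have := h2.trans ht
    have := sub_nonneg.2 h12
    gcongr
  have h6 := norm_sub_le (tip β t r₂ ^ 2 - tip β t r₁ ^ 2 + 4 * (r₂ - r₁)) (4 * ((r₂ : ℂ) - r₁))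
  rw [add_sub_cancel_right] at h6
  unfold lipConst
  linarith

theorem continuousOn_tip (h : IsDrift β T K) (ht : t ≤ T) :
    ContinuousOn (tip β t) (Ioc 0 t) := by
  intro r hr
  refine tendsto_of_sq_tendsto (eventually_mem_nhdsWithin.mono fun x hx => h.im_tip_pos ht hx)
    (h.im_tip_pos ht hr) ?_
  have hC := h.lipConst_pos (hr.1.le.trans (hr.2.trans ht))
  rw [tendsto_iff_norm_sub_tendsto_zero]
  refine squeeze_zero' (Eventually.of_forall fun _ => norm_nonneg _)
    (g := fun x => lipConst K T * |x - r|) (eventually_mem_nhdsWithin.mono fun x hx => ?_) ?_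
  · rcases le_total r x with hrx | hrx
    · rw [abs_of_nonneg (sub_nonneg.2 hrx)]
      exact h.norm_tip_sq_sub_le' ht hr.1.le hrx hx.2
    · rw [abs_sub_comm, abs_of_nonneg (sub_nonneg.2 hrx), norm_sub_rev]
      exact h.norm_tip_sq_sub_le' ht hx.1.le hrx hr.2
  · have : Continuous fun x => lipConst K T * |x - r| := by fun_prop
    simpa using (this.tendsto r).mono_left nhdsWithin_le_nhds

/-- The limit `y → 0` of `IsBackward.sq_sub_sq` for the shifted orbit from `t + δ` and the orbit
from `t`. The latter starts at `0`, so the initial gap is the square of the point reached by the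
former at time `δ`. At `r = t` this is the increment of the squared trace. -/
theorem tip_shift (h : IsDrift β T K) (h0 : 0 ≤ t) {δ : ℝ} (hδ : 0 ≤ δ) (ht : t + δ ≤ T)
    (hr : r ∈ Icc 0 t) :
    tip β (t + δ) (δ + r) ^ 2 - tip β t r ^ 2 = tip β (t + δ) δ ^ 2 *
      Complex.exp (∫ x in 0..r, 2 * (β (t - x) : ℂ) / (tip β (t + δ) (δ + x) + tip β t x)) := by
  have ht' : t ≤ T := by linarith
  have hl : ∀ x ∈ Icc 0 t, Tendsto (fun y => backSol β (t + δ) y (δ + x)) (𝓝[>] 0)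
      (𝓝 (tip β (t + δ) (δ + x))) := fun x hx =>
    h.tendsto_tip ht ⟨add_nonneg hδ hx.1, by linarith [hx.2]⟩
  have hβ := continuousOn_comp_sub h.continuousOn ht'
  refine tendsto_nhds_unique (((hl r hr).pow 2).sub ((h.tendsto_tip ht' hr).pow 2)) ?_
  have hL0 := ((hl 0 ⟨le_rfl, h0⟩).pow 2).sub ((h.tendsto_tip ht' ⟨le_rfl, h0⟩).pow 2)
  rw [h.tip_zero h0 ht', add_zero, zero_pow two_ne_zero, sub_zero] at hL0
  have hint : Tendsto (fun y => ∫ x in 0..r, 2 * (β (t - x) : ℂ) /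
      (backSol β (t + δ) y (δ + x) + backSol β t y x)) (𝓝[>] 0)
      (𝓝 (∫ x in 0..r, 2 * (β (t - x) : ℂ) / (tip β (t + δ) (δ + x) + tip β t x))) := by
    refine tendsto_integral_of_norm_le_inv_sqrt (C := 2 * K) (K := K) hr.1 ?_ ?_ ?_
    · filter_upwards [self_mem_nhdsWithin] with y hy
      have h1 := (h.backSol_spec (by linarith) ht hy).2.shift hδ
      have h2 := (h.backSol_spec h0 ht' hy).2
      have hc : ContinuousOn (fun x => 2 * (β (t - x) : ℂ) /
          (backSol β (t + δ) y (δ + x) + backSol β t y x)) (Icc 0 t) :=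
        ContinuousOn.div (continuousOn_const.mul (Complex.continuous_ofReal.comp_continuousOn hβ))
          (h1.continuousOn.add h2.continuousOn) fun x hx => h1.add_ne_zero h2 hx
      exact (hc.mono (Ioc_subset_Icc_self.trans
        (Icc_subset_Icc_right hr.2))).aestronglyMeasurable measurableSet_Ioc
    · filter_upwards [self_mem_nhdsWithin] with y hy x hx
      have h1 := (h.backSol_spec (by linarith) ht hy).2.shift hδ
      have h2 := (h.backSol_spec h0 ht' hy).2
      have hx1 : x ∈ Ioc 0 t := ⟨hx.1, hx.2.trans hr.2⟩
      have hx2 : x ∈ Icc 0 t := ⟨hx1.1.le, hx1.2⟩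
      rw [norm_div, norm_mul, Complex.norm_ofNat, Complex.norm_real, Real.norm_eq_abs,
        div_eq_mul_inv]
      have := h.K_pos (h0.trans ht')
      gcongr
      · exact (h.abs_sub_lt ht' x hx2).le
      · exact (norm_inv_add_le (h1.im_pos x hx2) (h2.im_pos x hx2)).trans
          (h.backSol_inv_im_le ht' hy hx1)
    · refine Eventually.of_forall fun x hx => ?_
      have hx1 : x ∈ Ioc 0 t := ⟨hx.1, hx.2.trans hr.2⟩
      have hx2 : x ∈ Icc 0 t := ⟨hx1.1.le, hx1.2⟩
      refine tendsto_const_nhds.div ((hl x hx2).add (h.tendsto_tip ht' hx2)) fun h3 => ?_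
      have h4 := congrArg Complex.im h3
      have h5 := h.im_tip_pos ht' hx1
      have h6 : 0 < (tip β (t + δ) (δ + x)).im :=
        h.im_tip_pos ht ⟨by linarith [hx.1], by linarith [hx1.2]⟩
      simp only [Complex.add_im, Complex.zero_im] at h4
      linarith
  refine (hL0.mul hint.cexp).congr' ?_
  filter_upwards [self_mem_nhdsWithin] with y hy
  have h1 := (h.backSol_spec (by linarith) ht hy).2.shift hδ
  have h2 := (h.backSol_spec h0 ht' hy).2
  have := h1.sq_sub_sq h2 hβ hr
  simp only [add_zero] at this
  simp only [this]

theorem norm_tip_shift_le (h : IsDrift β T K) (h0 : 0 ≤ t) {δ : ℝ} (hδ : 0 ≤ δ) (ht : t + δ ≤ T)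
    (hr : r ∈ Icc 0 t) :
    ‖tip β (t + δ) (δ + r) ^ 2 - tip β t r ^ 2‖ ≤ ‖tip β (t + δ) δ ^ 2‖ * compConst K T := by
  have ht' : t ≤ T := by linarith
  have hl : ∀ x ∈ Icc 0 t, Tendsto (fun y => backSol β (t + δ) y (δ + x)) (𝓝[>] 0)
      (𝓝 (tip β (t + δ) (δ + x))) := fun x hx =>
    h.tendsto_tip ht ⟨add_nonneg hδ hx.1, by linarith [hx.2]⟩
  have hL0 := ((hl 0 ⟨le_rfl, h0⟩).pow 2).sub ((h.tendsto_tip ht' ⟨le_rfl, h0⟩).pow 2)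
  rw [h.tip_zero h0 ht', add_zero, zero_pow two_ne_zero, sub_zero] at hL0
  refine le_of_tendsto_of_tendsto (((hl r hr).pow 2).sub ((h.tendsto_tip ht' hr).pow 2)).norm
    (hL0.norm.mul_const _) ?_
  filter_upwards [self_mem_nhdsWithin] with y hy
  have h1 := (h.backSol_spec (by linarith) ht hy).2.shift hδ
  have h2 := (h.backSol_spec h0 ht' hy).2
  have h3 := h1.norm_sq_sub_sq_le h2 (continuousOn_comp_sub h.continuousOn ht')
    (h.abs_sub_lt ht') (fun r hr => h.backSol_inv_im_le ht' hy hr) hr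
  simp only [add_zero] at h3 ⊢
  exact h3.trans (mul_le_mul_of_nonneg_left
    (compConst_mono (h.K_pos (h0.trans ht')).le ht') (norm_nonneg _))

end IsDrift

/-- The integral along the limiting backward orbit from time `t` of `k` divided by the orbit. -/
def tipIntegral (β : ℝ → ℝ) (k : ℝ → ℂ) (t : ℝ) : ℂ := ∫ x in 0..t, k (t - x) / tip β t x

/-! ### Dependence of the limiting orbits and of their integrals on time -/

namespace IsDrift

variable {β : ℝ → ℝ} {T K t r y : ℝ} {k : ℝ → ℂ}

theorem tendsto_tip_shift (h : IsDrift β T K) (h0 : 0 ≤ t) (ht : t < T) (hr : r ∈ Ioc 0 t) :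
    Tendsto (fun δ => tip β (t + δ) (δ + r)) (𝓝[>] 0) (𝓝 (tip β t r)) := by
  have hev : ∀ᶠ δ in 𝓝[>] (0 : ℝ), δ ∈ Ioo 0 (T - t) := Ioo_mem_nhdsGT (sub_pos.2 ht)
  refine tendsto_of_sq_tendsto (hev.mono fun δ hδ => h.im_tip_pos (by linarith [hδ.2])
    ⟨add_pos hδ.1 hr.1, by linarith [hr.2]⟩) (h.im_tip_pos ht.le hr) ?_
  rw [tendsto_iff_norm_sub_tendsto_zero]
  refine squeeze_zero' (Eventually.of_forall fun _ => norm_nonneg _)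
    (g := fun δ => lipConst K T * δ * compConst K T) (hev.mono fun δ hδ => ?_) ?_
  · refine (h.norm_tip_shift_le h0 hδ.1.le (by linarith [hδ.2]) ⟨hr.1.le, hr.2⟩).trans ?_
    have h1 := h.norm_tip_sq_sub_le' (t := t + δ) (by linarith [hδ.2]) le_rfl hδ.1.le
      (by linarith)
    rw [h.tip_zero (by linarith [hδ.1]) (by linarith [hδ.2]), zero_pow two_ne_zero, sub_zero,
      sub_zero] at h1
    exact mul_le_mul_of_nonneg_right h1 (compConst_pos _ _).le
  · have : Continuous fun δ => lipConst K T * δ * compConst K T := by fun_prop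
    simpa using (this.tendsto 0).mono_left nhdsWithin_le_nhds

theorem norm_tip_time_sub_le (h : IsDrift β T K) {t₁ t₂ : ℝ} (h12 : t₁ ≤ t₂) (h2 : t₂ ≤ T)
    (hr : r ∈ Icc 0 t₁) : ‖tip β t₂ r ^ 2 - tip β t₁ r ^ 2‖ ≤
      (lipConst K T + lipConst K T * compConst K T) * (t₂ - t₁) := by
  obtain ⟨δ, rfl⟩ : ∃ δ, t₂ = t₁ + δ := ⟨t₂ - t₁, by ring⟩
  have hδ : 0 ≤ δ := by linarith
  have h0 : 0 ≤ t₁ := hr.1.trans hr.2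
  have e1 := h.norm_tip_sq_sub_le' h2 hr.1 (show r ≤ δ + r by linarith) (by linarith [hr.2])
  have e2 := h.norm_tip_shift_le h0 hδ h2 hr
  have e3 := h.norm_tip_sq_sub_le' h2 le_rfl hδ (by linarith)
  rw [h.tip_zero (by linarith) h2, zero_pow two_ne_zero, sub_zero, sub_zero] at e3
  have e4 := mul_le_mul_of_nonneg_right e3 (compConst_pos K T).le
  have e5 := norm_sub_le_norm_sub_add_norm_sub (tip β (t₁ + δ) r ^ 2)
    (tip β (t₁ + δ) (δ + r) ^ 2) (tip β t₁ r ^ 2)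
  rw [norm_sub_rev (tip β (t₁ + δ) r ^ 2) (tip β (t₁ + δ) (δ + r) ^ 2)] at e5
  have e6 : δ + r - r = δ := by ring
  rw [e6] at e1
  have e7 : t₁ + δ - t₁ = δ := by ring
  rw [e7]
  nlinarith

theorem tendsto_tip_time (h : IsDrift β T K) (ht : t ∈ Icc 0 T) (hr : r ∈ Ioo 0 t) :
    Tendsto (fun s => tip β s r) (𝓝[Icc 0 T] t) (𝓝 (tip β t r)) := by
  have hev : ∀ᶠ s in 𝓝[Icc 0 T] t, s ∈ Icc 0 T ∧ r < s :=
    (eventually_mem_nhdsWithin).and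
      ((lt_mem_nhds hr.2).filter_mono nhdsWithin_le_nhds)
  refine tendsto_of_sq_tendsto (hev.mono fun s hs => h.im_tip_pos hs.1.2 ⟨hr.1, hs.2.le⟩)
    (h.im_tip_pos ht.2 ⟨hr.1, hr.2.le⟩) ?_
  rw [tendsto_iff_norm_sub_tendsto_zero]
  refine squeeze_zero' (Eventually.of_forall fun _ => norm_nonneg _)
    (g := fun s => (lipConst K T + lipConst K T * compConst K T) * |s - t|)
    (hev.mono fun s hs => ?_) ?_
  · rcases le_total t s with hts | hts
    · rw [abs_of_nonneg (sub_nonneg.2 hts)]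
      exact h.norm_tip_time_sub_le hts hs.1.2 ⟨hr.1.le, hr.2.le⟩
    · rw [abs_sub_comm, abs_of_nonneg (sub_nonneg.2 hts), norm_sub_rev]
      exact h.norm_tip_time_sub_le hts ht.2 ⟨hr.1.le, hs.2.le⟩
  · have : Continuous fun s => (lipConst K T + lipConst K T * compConst K T) * |s - t| := by
      fun_prop
    simpa using (this.tendsto t).mono_left nhdsWithin_le_nhds

theorem tendsto_integral_backSol (h : IsDrift β T K) (ht : t ∈ Icc 0 T)
    (hk : ContinuousOn k (Icc 0 T)) :
    Tendsto (fun y => ∫ x in 0..t, k (t - x) / backSol β t y x) (𝓝[>] 0)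
      (𝓝 (tipIntegral β k t)) := by
  obtain ⟨C, hC⟩ := isCompact_Icc.exists_bound_of_continuousOn hk
  have hC0 : 0 ≤ C := (norm_nonneg _).trans (hC t ht)
  refine tendsto_integral_of_norm_le_inv_sqrt (C := C) (K := K) ht.1 ?_ ?_ ?_
  · filter_upwards [self_mem_nhdsWithin] with y hy
    have h1 := (h.backSol_spec ht.1 ht.2 hy).2
    have hc : ContinuousOn (fun x => k (t - x) / backSol β t y x) (Icc 0 t) :=
      (continuousOn_comp_sub hk ht.2).div h1.continuousOn fun x hx => h1.ne_zero hx
    exact (hc.mono Ioc_subset_Icc_self).aestronglyMeasurable measurableSet_Ioc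
  · filter_upwards [self_mem_nhdsWithin] with y hy x hx
    have h1 := (h.backSol_spec ht.1 ht.2 hy).2
    have hx' := Ioc_subset_Icc_self hx
    rw [norm_div, div_eq_mul_inv]
    gcongr
    · exact hC _ (mapsTo_sub ht.2 hx')
    · exact (inv_anti₀ (h1.im_pos x hx') ((le_abs_self _).trans
        (Complex.abs_im_le_norm _))).trans (h.backSol_inv_im_le ht.2 hy hx)
  · exact Eventually.of_forall fun x hx => tendsto_const_nhds.div
      (h.tendsto_tip ht.2 (Ioc_subset_Icc_self hx)) (h.tip_ne_zero ht.2 hx)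

theorem continuousOn_tipIntegral (h : IsDrift β T K) (hk : ContinuousOn k (Icc 0 T)) :
    ContinuousOn (tipIntegral β k) (Icc 0 T) := by
  intro t ht
  obtain ⟨C, hC⟩ := isCompact_Icc.exists_bound_of_continuousOn hk
  have hC0 : 0 ≤ C := (norm_nonneg _).trans (hC t ht)
  have hK := h.K_pos (ht.1.trans ht.2)
  -- The moving endpoint is absorbed into an indicator on the fixed interval `[0, T]`, so that
  -- dominated convergence applies.
  have key : Tendsto (fun s => ∫ x in 0..T, {x | x ≤ s}.indicator
      (fun x => k (s - x) / tip β s x) x) (𝓝[Icc 0 T] t) (𝓝 (∫ x in 0..T, {x | x ≤ t}.indicator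
      (fun x => k (t - x) / tip β t x) x)) := by
    refine tendsto_integral_of_norm_le_inv_sqrt (C := C) (K := K) (ht.1.trans ht.2) ?_ ?_ ?_
    · filter_upwards [self_mem_nhdsWithin] with s hs
      change AEStronglyMeasurable ((Iic s).indicator _) _
      rw [aestronglyMeasurable_indicator_iff measurableSet_Iic,
        Measure.restrict_restrict measurableSet_Iic]
      have hc : ContinuousOn (fun x => k (s - x) / tip β s x) (Ioc 0 s) :=
        ((continuousOn_comp_sub hk hs.2).mono Ioc_subset_Icc_self).div (h.continuousOn_tip hs.2)
          fun x hx => h.tip_ne_zero hs.2 hx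
      exact (hc.mono fun x hx => ⟨hx.2.1, hx.1⟩).aestronglyMeasurable
        (measurableSet_Iic.inter measurableSet_Ioc)
    · filter_upwards [self_mem_nhdsWithin] with s hs x hx
      have h1 : 0 ≤ C * ((√x)⁻¹ + K) := by positivity
      by_cases hxs : x ≤ s
      · rw [indicator_of_mem (show x ∈ {x | x ≤ s} from hxs), norm_div, div_eq_mul_inv]
        gcongr
        · exact hC _ (mapsTo_sub hs.2 ⟨hx.1.le, hxs⟩)
        · exact h.norm_inv_tip_le hs.2 ⟨hx.1, hxs⟩
      · rw [indicator_of_notMem (show x ∉ {x | x ≤ s} from hxs), norm_zero]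
        exact h1
    -- Pointwise convergence may fail only at `x = t`, where the indicator jumps.
    · filter_upwards [compl_mem_ae_iff.2 (measure_singleton t)] with x hxt hx
      rcases lt_or_gt_of_ne (show x ≠ t from hxt) with hlt | hgt
      · rw [indicator_of_mem (show x ∈ {x | x ≤ t} from hlt.le)]
        have h1 : Tendsto (fun s => k (s - x)) (𝓝[Icc 0 T] t) (𝓝 (k (t - x))) := by
          refine (hk (t - x) ⟨by linarith, by linarith [hx.1, ht.2]⟩).tendsto.comp
            (tendsto_nhdsWithin_iff.2 ⟨?_, ?_⟩)
          · exact ((continuous_id.sub continuous_const).tendsto t).mono_left nhdsWithin_le_nhds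
          · filter_upwards [self_mem_nhdsWithin, nhdsWithin_le_nhds (lt_mem_nhds hlt)]
              with s hs hxs
            exact ⟨by linarith, by linarith [hx.1, hs.2]⟩
        refine (h1.div (h.tendsto_tip_time ht ⟨hx.1, hlt⟩)
          (h.tip_ne_zero ht.2 ⟨hx.1, hlt.le⟩)).congr' ?_
        filter_upwards [nhdsWithin_le_nhds (lt_mem_nhds hlt)] with s hxs
        rw [indicator_of_mem (show x ∈ {x | x ≤ s} from le_of_lt hxs)]
        rfl
      · rw [indicator_of_notMem (show x ∉ {x | x ≤ t} from not_le.2 hgt)]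
        refine tendsto_const_nhds.congr' ?_
        filter_upwards [nhdsWithin_le_nhds (gt_mem_nhds hgt)] with s hxs
        rw [indicator_of_notMem (show x ∉ {x | x ≤ s} from not_le.2 hxs)]
  have he : ∀ s ∈ Icc 0 T, ∫ x in 0..T, {x | x ≤ s}.indicator
      (fun x => k (s - x) / tip β s x) x = tipIntegral β k s := fun s hs =>
    intervalIntegral.integral_indicator hs
  rw [he t ht] at key
  exact key.congr' (eventually_mem_nhdsWithin.mono he)

/-! ### The trace -/

theorem norm_trace_sq_sub_le (h : IsDrift β T K) {t₁ t₂ : ℝ} (h1 : 0 ≤ t₁) (h12 : t₁ ≤ t₂)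
    (h2 : t₂ ≤ T) :
    ‖tip β t₂ t₂ ^ 2 - tip β t₁ t₁ ^ 2‖ ≤ lipConst K T * compConst K T * (t₂ - t₁) := by
  obtain ⟨δ, rfl⟩ : ∃ δ, t₂ = t₁ + δ := ⟨t₂ - t₁, by ring⟩
  have hδ : 0 ≤ δ := by linarith
  have e2 := h.norm_tip_shift_le h1 hδ h2 ⟨h1, le_rfl⟩
  have e3 := h.norm_tip_sq_sub_le' h2 le_rfl hδ (by linarith)
  rw [h.tip_zero (by linarith) h2, zero_pow two_ne_zero, sub_zero, sub_zero] at e3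
  have e4 := mul_le_mul_of_nonneg_right e3 (compConst_pos K T).le
  rw [add_comm δ t₁] at e2
  have e7 : t₁ + δ - t₁ = δ := by ring
  rw [e7]
  nlinarith

theorem le_im_trace (h : IsDrift β T K) (ht : t ∈ Icc 0 T) :
    (1 + K * √T)⁻¹ * √t ≤ (tip β t t).im := by
  have hK := h.K_pos (ht.1.trans ht.2)
  rcases ht.1.eq_or_lt with rfl | h0
  · simp [h.tip_zero le_rfl ht.2]
  · refine le_trans ?_ (h.le_im_tip ht.2 ⟨h0, le_rfl⟩)
    have hs := Real.sqrt_pos.2 h0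
    have hs2 := Real.sqrt_le_sqrt ht.2
    have e : ((√t)⁻¹ + K)⁻¹ = (1 + K * √t)⁻¹ * √t := by
      field_simp
    rw [e]
    gcongr

/-- Write `γ₂² - γ₁² = (γ₂ - γ₁)(γ₂ + γ₁)`. The left side is `O(t₂ - t₁) = O((√t₂ - √t₁)(√t₂ +
√t₁))`, while `Im(γ₂ + γ₁)` is at least a multiple of `√t₂ + √t₁`. The bound telescopes, so it
controls the length even at time `0`, where the formula for the velocity degenerates. -/
theorem exists_norm_trace_sub_le (h : IsDrift β T K) : ∃ C : ℝ, 0 ≤ C ∧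
    ∀ t₁ t₂, 0 ≤ t₁ → t₁ ≤ t₂ → t₂ ≤ T →
      ‖tip β t₂ t₂ - tip β t₁ t₁‖ ≤ C * (√t₂ - √t₁) := by
  by_cases hT : 0 ≤ T
  swap
  · exact ⟨0, le_rfl, fun t₁ t₂ h1 h12 h2 => absurd (h1.trans (h12.trans h2)) hT⟩
  have hK := h.K_pos hT
  have hL := h.lipConst_pos hT
  have hC := compConst_pos K T
  refine ⟨lipConst K T * compConst K T * (1 + K * √T), by positivity, fun t₁ t₂ h1 h12 h2 => ?_⟩
  rcases h12.eq_or_lt with rfl | hlt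
  · simp
  have hs := Real.sqrt_pos.2 (h1.trans_lt hlt)
  have i1 := h.le_im_trace ⟨h1, h12.trans h2⟩
  have i2 := h.le_im_trace ⟨h1.trans h12, h2⟩
  have hn : (1 + K * √T)⁻¹ * (√t₂ + √t₁) ≤ ‖tip β t₂ t₂ + tip β t₁ t₁‖ := by
    refine le_trans ?_ ((le_abs_self _).trans (Complex.abs_im_le_norm _))
    rw [Complex.add_im, mul_add]
    exact add_le_add i2 i1
  have e1 := h.norm_trace_sq_sub_le h1 h12 h2
  have e2 : tip β t₂ t₂ ^ 2 - tip β t₁ t₁ ^ 2 =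
    (tip β t₂ t₂ - tip β t₁ t₁) * (tip β t₂ t₂ + tip β t₁ t₁) := by ring
  have e3 : t₂ - t₁ = (√t₂ - √t₁) * (√t₂ + √t₁) := by
    ring_nf
    rw [Real.sq_sqrt h1, Real.sq_sqrt (h1.trans h12)]
  rw [e2, norm_mul, e3] at e1
  have e4 := (mul_le_mul_of_nonneg_left hn (norm_nonneg (tip β t₂ t₂ - tip β t₁ t₁))).trans e1
  have hs1 := Real.sqrt_nonneg t₁
  have hpos : 0 < √t₂ + √t₁ := by linarith
  have e5 : ‖tip β t₂ t₂ - tip β t₁ t₁‖ * (1 + K * √T)⁻¹ ≤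
      lipConst K T * compConst K T * (√t₂ - √t₁) := by
    refine le_of_mul_le_mul_right ?_ hpos
    linarith
  rw [← div_eq_mul_inv, div_le_iff₀ (by positivity)] at e5
  linarith

/-- Divide `tip_shift` at `r = t` by `δ`: the initial gap contributes `-4`, and in the exponent both
orbits converge to `tip β t`, turning `2β/(u₁ + u₂)` into `β/tip`. -/
theorem hasDerivWithinAt_trace_sq_Ici (h : IsDrift β T K) (h0 : 0 ≤ t) (ht : t < T) :
    HasDerivWithinAt (fun t => tip β t t ^ 2)
      (-4 * Complex.exp (tipIntegral β (fun s => (β s : ℂ)) t)) (Ici t) t := by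
  have hK := h.K_pos (h0.trans ht.le)
  have hev : ∀ᶠ δ in 𝓝[>] (0 : ℝ), δ ∈ Ioo 0 (T - t) := Ioo_mem_nhdsGT (sub_pos.2 ht)
  have hβ := continuousOn_comp_sub h.continuousOn ht.le
  have hint : Tendsto (fun δ => ∫ x in 0..t, 2 * (β (t - x) : ℂ) /
      (tip β (t + δ) (δ + x) + tip β t x)) (𝓝[>] 0)
      (𝓝 (∫ x in 0..t, (β (t - x) : ℂ) / tip β t x)) := by
    refine tendsto_integral_of_norm_le_inv_sqrt (C := 2 * K) (K := K) h0 ?_ ?_ ?_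
    · filter_upwards [hev] with δ hδ
      have hm : MapsTo (fun x => δ + x) (Ioc 0 t) (Ioc 0 (t + δ)) := fun x hx =>
        ⟨add_pos hδ.1 hx.1, by linarith [hx.2]⟩
      refine ContinuousOn.aestronglyMeasurable ?_ measurableSet_Ioc
      refine ContinuousOn.div ?_ (((h.continuousOn_tip (by linarith [hδ.2])).comp
        (by fun_prop) hm).add (h.continuousOn_tip ht.le)) fun x hx h3 => ?_
      · exact continuousOn_const.mul (Complex.continuous_ofReal.comp_continuousOn
          (hβ.mono Ioc_subset_Icc_self))
      · have h4 := congrArg Complex.im h3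
        have h5 := h.im_tip_pos ht.le hx
        have h6 := h.im_tip_pos (by linarith [hδ.2]) (hm hx)
        simp only [Complex.add_im, Complex.zero_im] at h4
        linarith
    · filter_upwards [hev] with δ hδ x hx
      have h5 := h.im_tip_pos ht.le hx
      have h6 := h.im_tip_pos (t := t + δ) (r := δ + x) (by linarith [hδ.2])
        ⟨add_pos hδ.1 hx.1, by linarith [hx.2]⟩
      rw [norm_div, norm_mul, Complex.norm_ofNat, Complex.norm_real, Real.norm_eq_abs,
        div_eq_mul_inv]
      gcongr
      · exact (h.abs_sub_lt ht.le x (Ioc_subset_Icc_self hx)).le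
      · exact (norm_inv_add_le h6 h5).trans (h.inv_im_tip_le ht.le hx)
    · refine Eventually.of_forall fun x hx => ?_
      have h5 := h.tip_ne_zero ht.le hx
      have h6 : Tendsto (fun δ => 2 * (β (t - x) : ℂ) / (tip β (t + δ) (δ + x) + tip β t x))
          (𝓝[>] 0) (𝓝 (2 * (β (t - x) : ℂ) / (tip β t x + tip β t x))) :=
        tendsto_const_nhds.div ((h.tendsto_tip_shift h0 ht hx).add_const _) (by
          rw [← two_mul]; exact mul_ne_zero two_ne_zero h5)
      convert h6 using 2
      field_simp
      norm_num
  have hfirst : Tendsto (fun δ : ℝ => tip β (t + δ) δ ^ 2 / (δ : ℂ)) (𝓝[>] 0) (𝓝 (-4)) := by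
    rw [tendsto_iff_norm_sub_tendsto_zero]
    refine squeeze_zero' (Eventually.of_forall fun _ => norm_nonneg _)
      (g := fun δ => 2 * K * (K * δ + 2 * √δ)) (hev.mono fun δ hδ => ?_) ?_
    · have h1 := h.norm_tip_sq_sub_le (t := t + δ) (by linarith [hδ.2]) le_rfl hδ.1.le
        (by linarith)
      rw [h.tip_zero (by linarith [hδ.1]) (by linarith [hδ.2]), zero_pow two_ne_zero, sub_zero,
        Complex.ofReal_zero, sub_zero, sub_zero] at h1
      have hδ0 : (δ : ℂ) ≠ 0 := by exact_mod_cast hδ.1.ne'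
      have e : tip β (t + δ) δ ^ 2 / (δ : ℂ) - -4 = (tip β (t + δ) δ ^ 2 + 4 * δ) / δ := by
        field_simp
        ring
      rw [e, norm_div, Complex.norm_real, Real.norm_of_nonneg hδ.1.le, div_le_iff₀ hδ.1]
      exact h1
    · have : Continuous fun δ => 2 * K * (K * δ + 2 * √δ) := by fun_prop
      simpa using (this.tendsto 0).mono_left nhdsWithin_le_nhds
  have hsub : Tendsto (fun s => s - t) (𝓝[>] t) (𝓝[>] 0) := by
    refine tendsto_nhdsWithin_iff.2 ⟨?_, eventually_mem_nhdsWithin.mono fun s hs =>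
      mem_Ioi.2 (sub_pos.2 hs)⟩
    have : Continuous fun s => s - t := by fun_prop
    simpa using (this.tendsto t).mono_left nhdsWithin_le_nhds
  rw [← hasDerivWithinAt_Ioi_iff_Ici, hasDerivWithinAt_iff_tendsto_slope' self_notMem_Ioi]
  refine ((hfirst.mul hint.cexp).comp hsub).congr' ?_
  filter_upwards [hsub.eventually hev] with s hs
  have := h.tip_shift h0 hs.1.le (by linarith [hs.2]) ⟨h0, le_rfl⟩
  have e1 : t + (s - t) = s := by ring
  have e2 : s - t + t = s := by ring
  rw [e1, e2] at this
  rw [slope_def_module, this, Function.comp_apply, Complex.real_smul, e1]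
  push_cast
  ring

theorem continuousOn_trace (h : IsDrift β T K) : ContinuousOn (fun t => tip β t t) (Icc 0 T) := by
  obtain ⟨C, hC0, hC⟩ := h.exists_norm_trace_sub_le
  intro t ht
  rw [ContinuousWithinAt, tendsto_iff_norm_sub_tendsto_zero]
  refine squeeze_zero' (Eventually.of_forall fun _ => norm_nonneg _)
    (g := fun s => C * |√s - √t|) (eventually_mem_nhdsWithin.mono fun s hs => ?_) ?_
  · rcases le_total t s with hts | hts
    · rw [abs_of_nonneg (sub_nonneg.2 (Real.sqrt_le_sqrt hts))]
      exact hC t s ht.1 hts hs.2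
    · rw [abs_sub_comm, abs_of_nonneg (sub_nonneg.2 (Real.sqrt_le_sqrt hts)), norm_sub_rev]
      exact hC s t hs.1 hts ht.2
  · have : Continuous fun s => C * |√s - √t| := by fun_prop
    simpa using (this.tendsto t).mono_left nhdsWithin_le_nhds

theorem hasDerivAt_trace (h : IsDrift β T K) (ht : t ∈ Ioo 0 T) :
    HasDerivAt (fun t => tip β t t)
      (-2 * Complex.exp (tipIntegral β (fun s => (β s : ℂ)) t) / tip β t t) t := by
  set G : ℝ → ℂ := fun t => -4 * Complex.exp (tipIntegral β (fun s => (β s : ℂ)) t) with hG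
  have hGc : ContinuousOn G (Icc 0 T) := continuousOn_const.mul
    (h.continuousOn_tipIntegral (Complex.continuous_ofReal.comp_continuousOn h.continuousOn)).cexp
  -- A continuous function with a continuous right derivative is its integral; this upgrades the
  -- one-sided derivative to a two-sided one.
  have hsq : ∀ s ∈ Icc 0 T, tip β s s ^ 2 = ∫ x in 0..s, G x := by
    have h1 := constant_of_has_deriv_right_zero (a := 0) (b := T)
      (f := fun s => tip β s s ^ 2 - ∫ x in 0..s, G x)
      ((h.continuousOn_trace.pow 2).sub fun s hs =>
        (hasDerivWithinAt_integral_Icc hGc hs).continuousWithinAt) fun s hs => by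
      have h2 := (hasDerivWithinAt_integral_Icc hGc ⟨hs.1, hs.2.le⟩).mono_of_mem_nhdsWithin
        (Icc_mem_nhdsGE_of_mem hs)
      exact ((h.hasDerivWithinAt_trace_sq_Ici hs.1 hs.2).sub h2).congr_deriv (sub_self _)
    intro s hs
    have h3 := h1 s hs
    simp only [h.tip_zero le_rfl (hs.1.trans hs.2), intervalIntegral.integral_same] at h3
    rw [← sub_eq_zero, h3]
    simp
  have hd : HasDerivAt (fun s => tip β s s ^ 2) (G t) t := by
    refine ((hasDerivWithinAt_integral_Icc hGc ⟨ht.1.le, ht.2.le⟩).hasDerivAt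
      (Icc_mem_nhds ht.1 ht.2)).congr_of_eventuallyEq ?_
    filter_upwards [Icc_mem_nhds ht.1 ht.2] with s hs using hsq s hs
  have hne : tip β t t ≠ 0 := h.tip_ne_zero ht.2.le ⟨ht.1, le_rfl⟩
  have hcont : Tendsto (fun s => tip β s s) (𝓝[≠] t) (𝓝 (tip β t t)) :=
    (h.continuousOn_trace.continuousAt (Icc_mem_nhds ht.1 ht.2)).tendsto.mono_left
      nhdsWithin_le_nhds
  rw [hasDerivAt_iff_tendsto_slope] at hd ⊢
  -- The slope of `γ` is the slope of `γ²` divided by `γ(s) + γ(t)`, which is nonzero in the upper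
  -- half-plane.
  have hlim := hd.div (hcont.add_const (tip β t t)) (by
    rw [← two_mul]; exact mul_ne_zero two_ne_zero hne)
  have e : -2 * Complex.exp (tipIntegral β (fun s => (β s : ℂ)) t) / tip β t t =
      G t / (tip β t t + tip β t t) := by
    simp only [hG]
    field_simp
    norm_num
  rw [e]
  refine hlim.congr' ?_
  filter_upwards [nhdsWithin_le_nhds (Ioo_mem_nhds ht.1 ht.2)] with s hs
  have h1 := h.im_tip_pos hs.2.le ⟨hs.1, le_rfl⟩
  have h2 := h.im_tip_pos ht.2.le ⟨ht.1, le_rfl⟩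
  have h3 : tip β s s + tip β t t ≠ 0 := fun h3 => by
    have h4 := congrArg Complex.im h3
    simp only [Complex.add_im, Complex.zero_im] at h4
    linarith
  rw [Pi.div_apply, div_eq_iff h3]
  simp only [slope_def_module, Complex.real_smul]
  ring

end IsDrift

/-! ### Loewner orbits -/

theorem hasDerivWithinAt_ofReal {f : ℝ → ℝ} {f' : ℝ} {s : Set ℝ} {x : ℝ}
    (h : HasDerivWithinAt f f' s x) : HasDerivWithinAt (fun t => (f t : ℂ)) (f' : ℂ) s x :=
  Complex.ofRealCLM.hasFDerivAt.comp_hasDerivWithinAt x h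

namespace IsLoewnerOrbit

variable {W : ℝ → ℝ} {t : ℝ} {z z₁ z₂ : ℂ} {u u₁ u₂ : ℝ → ℂ}

theorem continuousOn {J : Set ℝ} (h : IsLoewnerOrbit W J z u) : ContinuousOn u J :=
  fun s hs => (h.hasDeriv s hs).continuousWithinAt

/-- The difference solves a linear equation. Equal initial values give uniqueness of the orbit;
equal final values give injectivity of the Loewner map, since the exponential never vanishes. -/
theorem sub_eq (hW : ContinuousOn W (Icc 0 t)) (h1 : IsLoewnerOrbit W (Icc 0 t) z₁ u₁)
    (h2 : IsLoewnerOrbit W (Icc 0 t) z₂ u₂) {s : ℝ} (hs : s ∈ Icc 0 t) :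
    u₁ s - u₂ s = (z₁ - z₂) * Complex.exp (∫ x in 0..s, -2 / ((u₁ x - W x) * (u₂ x - W x))) := by
  rw [← h1.initial, ← h2.initial]
  have n1 : ∀ s ∈ Icc 0 t, u₁ s - W s ≠ 0 := fun s hs => sub_ne_zero.2 (h1.ne_driving s hs)
  have n2 : ∀ s ∈ Icc 0 t, u₂ s - W s ≠ 0 := fun s hs => sub_ne_zero.2 (h2.ne_driving s hs)
  have hWc : ContinuousOn (fun s => (W s : ℂ)) (Icc 0 t) :=
    Complex.continuous_ofReal.comp_continuousOn hW
  refine eq_mul_exp_integral (f := fun s => u₁ s - u₂ s) (b := t) ?_ (fun s hs => ?_) hs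
  · exact continuousOn_const.div ((h1.continuousOn.sub hWc).mul (h2.continuousOn.sub hWc))
      fun s hs => mul_ne_zero (n1 s hs) (n2 s hs)
  · refine ((h1.hasDeriv s hs).sub (h2.hasDeriv s hs)).congr_deriv ?_
    have := n1 s hs
    have := n2 s hs
    field_simp
    ring

theorem loewnerMap_eq (hW : ContinuousOn W (Icc 0 t)) (ht : 0 ≤ t)
    (h : IsLoewnerOrbit W (Icc 0 t) z u) : loewnerMap W t z = u t := by
  have hex : ∃ u : ℝ → ℂ, IsLoewnerOrbit W (Icc 0 t) z u := ⟨u, h⟩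
  rw [loewnerMap, dif_pos hex]
  have := sub_eq hW hex.choose_spec h ⟨ht, le_rfl⟩
  rwa [sub_self, zero_mul, sub_eq_zero] at this

theorem loewnerInv_eq (hW : ContinuousOn W (Icc 0 t)) (ht : 0 ≤ t)
    (h : IsLoewnerOrbit W (Icc 0 t) z u) (hz : 0 < z.im) : loewnerInv W t (u t) = z := by
  have hmem : z ∈ loewnerDomain W t := ⟨hz, u, h⟩
  have himg : u t ∈ loewnerMap W t '' loewnerDomain W t := ⟨z, hmem, h.loewnerMap_eq hW ht⟩
  have h1 := Function.invFunOn_mem himg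
  have h2 := Function.invFunOn_eq himg
  obtain ⟨-, v, hv⟩ := h1
  have h3 : v t = u t := (hv.loewnerMap_eq hW ht).symm.trans h2
  have h4 := sub_eq hW hv h ⟨ht, le_rfl⟩
  rw [h3, sub_self, eq_comm, mul_eq_zero, or_iff_left (Complex.exp_ne_zero _), sub_eq_zero] at h4
  exact h4

end IsLoewnerOrbit

namespace IsDrift

variable {β : ℝ → ℝ} {T K t r y : ℝ} {k : ℝ → ℂ} {W : ℝ → ℝ} {A : ℝ → ℂ}

/-- Reversing time and undoing the centering at the driving function turns the backward orbit into a
forward one ending at `Wₜ + iy`. -/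
theorem isLoewnerOrbit_backSol (h : IsDrift β T K) (ht : t ∈ Icc 0 T)
    (hW : ∀ s ∈ Icc 0 T, HasDerivWithinAt W (β s) (Icc 0 T) s) (hy : 0 < y) :
    IsLoewnerOrbit W (Icc 0 t) (backSol β t y t + W 0) fun s => backSol β t y (t - s) + W s := by
  have hs := (h.backSol_spec ht.1 ht.2 hy).2
  have hm : MapsTo (fun s => t - s) (Icc 0 t) (Icc 0 t) := fun s hs =>
    ⟨sub_nonneg.2 hs.2, by linarith [hs.1]⟩
  have hsub : Icc 0 t ⊆ Icc 0 T := Icc_subset_Icc_right ht.2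
  refine ⟨by simp, fun s hs' h0 => ?_, fun s hs' => ?_⟩
  · exact hs.ne_zero (hm hs') (by simpa using h0)
  · have h1 := (hs.hasDeriv (t - s) (hm hs')).scomp s
      (((hasDerivAt_id s).const_sub t).hasDerivWithinAt) hm
    refine (h1.add (hasDerivWithinAt_ofReal ((hW s (hsub hs')).mono hsub))).congr_deriv ?_
    simp [neg_div]

theorem loewnerInv_eq_backSol (h : IsDrift β T K) (ht : t ∈ Icc 0 T)
    (hW : ∀ s ∈ Icc 0 T, HasDerivWithinAt W (β s) (Icc 0 T) s) (hy : 0 < y) :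
    loewnerInv W t (W t + y * Complex.I) = backSol β t y t + W 0 := by
  have hs := h.backSol_spec ht.1 ht.2 hy
  have hWc : ContinuousOn W (Icc 0 t) := fun s hs =>
    ((hW s ⟨hs.1, hs.2.trans ht.2⟩).mono (Icc_subset_Icc_right ht.2)).continuousWithinAt
  have := (h.isLoewnerOrbit_backSol ht hW hy).loewnerInv_eq hWc ht.1
    (by simpa using hs.2.im_pos t ⟨ht.1, le_rfl⟩)
  rwa [sub_self, hs.1, add_comm] at this

theorem tendsto_loewnerInv (h : IsDrift β T K) (ht : t ∈ Icc 0 T)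
    (hW : ∀ s ∈ Icc 0 T, HasDerivWithinAt W (β s) (Icc 0 T) s) :
    Tendsto (fun y : ℝ => loewnerInv W t ((W t : ℂ) + (y : ℂ) * Complex.I))
      (𝓝[>] 0) (𝓝 (tip β t t + W 0)) := by
  refine ((h.tendsto_tip ht.2 ⟨ht.1, le_rfl⟩).add_const (W 0 : ℂ)).congr' ?_
  filter_upwards [self_mem_nhdsWithin] with y hy
  exact (h.loewnerInv_eq_backSol ht hW hy).symm

/-! ### The evolution of the distance to the force point -/

/-- The drift cancels in the difference, and `-2/u + 2/A = (2/(A u)) (u - A)`. The logarithm of the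
difference therefore increases by `∫ (2/A)/u`. -/
theorem hasDerivWithinAt_backSol_sub (h : IsDrift β T K) (ht : t ∈ Icc 0 T)
    (hA0 : ∀ s ∈ Icc 0 T, A s ≠ 0)
    (hA : ∀ s ∈ Icc 0 T, HasDerivWithinAt A (2 / A s - β s) (Icc 0 T) s) (hy : 0 < y)
    (hr : r ∈ Icc 0 t) :
    HasDerivWithinAt (fun r => backSol β t y r - A (t - r))
      (2 / A (t - r) / backSol β t y r * (backSol β t y r - A (t - r))) (Icc 0 t) r := by
  have hs := (h.backSol_spec ht.1 ht.2 hy).2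
  have h1 := (hA (t - r) (mapsTo_sub ht.2 hr)).scomp r
    (((hasDerivAt_id r).const_sub t).hasDerivWithinAt) (mapsTo_sub ht.2)
  refine ((hs.hasDeriv r hr).sub h1).congr_deriv ?_
  have := hs.ne_zero hr
  have := hA0 (t - r) (mapsTo_sub ht.2 hr)
  rw [neg_smul, one_smul]
  field_simp
  ring

theorem continuousOn_two_div (hA0 : ∀ s ∈ Icc 0 T, A s ≠ 0)
    (hA : ∀ s ∈ Icc 0 T, HasDerivWithinAt A (2 / A s - β s) (Icc 0 T) s) :
    ContinuousOn (fun s => 2 / A s) (Icc 0 T) :=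
  continuousOn_const.div (fun s hs => (hA s hs).continuousWithinAt) hA0

theorem trace_sub_eq (h : IsDrift β T K) (ht : t ∈ Icc 0 T) (hA0 : ∀ s ∈ Icc 0 T, A s ≠ 0)
    (hA : ∀ s ∈ Icc 0 T, HasDerivWithinAt A (2 / A s - β s) (Icc 0 T) s) :
    tip β t t - A 0 = -A t * Complex.exp (tipIntegral β (fun s => 2 / A s) t) := by
  have hk := continuousOn_two_div hA0 hA
  have hlim : Tendsto (fun y : ℝ => (y : ℂ) * Complex.I - A t) (𝓝[>] 0) (𝓝 (-A t)) := by
    have : Continuous fun y : ℝ => (y : ℂ) * Complex.I - A t := by fun_prop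
    simpa using (this.tendsto 0).mono_left nhdsWithin_le_nhds
  refine tendsto_nhds_unique ((h.tendsto_tip ht.2 ⟨ht.1, le_rfl⟩).sub_const (A 0))
    ((hlim.mul (h.tendsto_integral_backSol ht hk).cexp).congr' ?_)
  filter_upwards [self_mem_nhdsWithin] with y hy
  have hs := h.backSol_spec ht.1 ht.2 hy
  have := eq_mul_exp_integral (f := fun r => backSol β t y r - A (t - r))
    (c := fun r => 2 / A (t - r) / backSol β t y r)
    ((continuousOn_comp_sub hk ht.2).div hs.2.continuousOn fun x hx => hs.2.ne_zero hx)
    (fun r hr => h.hasDerivWithinAt_backSol_sub ht hA0 hA hy hr) ⟨ht.1, le_rfl⟩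
  simp only [sub_self, sub_zero, hs.1] at this
  exact this.symm

theorem continuousWithinAt_log_of_im_nonneg {z : ℂ} (hz : z ≠ 0) :
    ContinuousWithinAt Complex.log {z | 0 ≤ z.im} z := by
  by_cases hs : z ∈ Complex.slitPlane
  · exact (continuousAt_clog hs).continuousWithinAt
  · rw [Complex.mem_slitPlane_iff, not_or, not_lt, not_not] at hs
    refine Complex.continuousWithinAt_log_of_re_neg_of_im_zero
      (lt_of_le_of_ne hs.1 fun h => hz (Complex.ext h hs.2)) hs.2

/-- The condition `Im A ≤ 0` keeps `u - A` in the open upper half-plane, so the principal logarithm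
can be followed along the orbit. Without it only the exponentiated form `trace_sub_eq` is available.
-/
theorem log_trace_sub_eq (h : IsDrift β T K) (h0 : 0 < t) (ht : t ≤ T)
    (hA0 : ∀ s ∈ Icc 0 T, A s ≠ 0)
    (hA : ∀ s ∈ Icc 0 T, HasDerivWithinAt A (2 / A s - β s) (Icc 0 T) s)
    (him : ∀ s ∈ Icc 0 T, (A s).im ≤ 0) :
    Complex.log (tip β t t - A 0) =
      Complex.log (-A t) + tipIntegral β (fun s => 2 / A s) t := by
  have ht' : t ∈ Icc 0 T := ⟨h0.le, ht⟩
  have hk := continuousOn_two_div hA0 hA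
  have hlim : Tendsto (fun y : ℝ => Complex.log ((y : ℂ) * Complex.I - A t)) (𝓝[>] 0)
      (𝓝 (Complex.log (-A t))) := by
    -- `-A t` may lie on the negative real axis, the cut of the logarithm; the approach is from
    -- above, where the logarithm is continuous up to the cut.
    refine (continuousWithinAt_log_of_im_nonneg (neg_ne_zero.2 (hA0 t ht'))).tendsto.comp (tendsto_nhdsWithin_iff.2 ⟨?_, ?_⟩)
    · have : Continuous fun y : ℝ => (y : ℂ) * Complex.I - A t := by fun_prop
      simpa using (this.tendsto 0).mono_left nhdsWithin_le_nhds
    · filter_upwards [self_mem_nhdsWithin] with y hy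
      have := him t ht'
      have : (0 : ℝ) < y := hy
      simp
      linarith
  have hpos : 0 < (tip β t t - A 0).im := by
    have := h.im_tip_pos ht ⟨h0, le_rfl⟩
    have := him 0 ⟨le_rfl, h0.le.trans ht⟩
    rw [Complex.sub_im]
    linarith
  refine tendsto_nhds_unique
    (((h.tendsto_tip ht ⟨h0.le, le_rfl⟩).sub_const (A 0)).clog (Or.inr hpos.ne'))
    ((hlim.add (h.tendsto_integral_backSol ht' hk)).congr' ?_)
  filter_upwards [self_mem_nhdsWithin] with y hy
  have hs := h.backSol_spec h0.le ht hy
  have hc : ContinuousOn (fun r => 2 / A (t - r) / backSol β t y r) (Icc 0 t) :=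
    (continuousOn_comp_sub hk ht).div hs.2.continuousOn fun x hx => hs.2.ne_zero hx
  have := eq_of_hasDerivWithinAt_zero_Icc (a := 0) (b := t)
    (f := fun r => Complex.log (backSol β t y r - A (t - r)) -
      ∫ x in 0..r, 2 / A (t - x) / backSol β t y x) (fun r hr => by
    have hq : 0 < (backSol β t y r - A (t - r)).im := by
      have := hs.2.im_pos r hr
      have := him _ (mapsTo_sub ht hr)
      rw [Complex.sub_im]
      linarith
    refine (((h.hasDerivWithinAt_backSol_sub ht' hA0 hA hy hr).clog_real (Or.inr hq.ne')).sub
      (hasDerivWithinAt_integral_Icc hc hr)).congr_deriv ?_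
    rw [mul_div_assoc, div_self (fun h0 => by simp [h0] at hq), mul_one, sub_self])
    t ⟨h0.le, le_rfl⟩
  simp only [sub_self, sub_zero, hs.1, intervalIntegral.integral_same] at this
  rw [← this]
  ring

theorem intervalIntegrable_div_tip (h : IsDrift β T K) (ht : t ∈ Icc 0 T)
    (hk : ContinuousOn k (Icc 0 T)) :
    IntervalIntegrable (fun x => k (t - x) / tip β t x) volume 0 t := by
  obtain ⟨C, hC⟩ := isCompact_Icc.exists_bound_of_continuousOn hk
  have hC0 : 0 ≤ C := (norm_nonneg _).trans (hC t ht)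
  refine ((intervalIntegrable_inv_sqrt_add 0 t K).const_mul C).mono_fun' ?_ ?_
  · rw [uIoc_of_le ht.1]
    exact (((continuousOn_comp_sub hk ht.2).mono Ioc_subset_Icc_self).div
      (h.continuousOn_tip ht.2) fun x hx => h.tip_ne_zero ht.2 hx).aestronglyMeasurable
        measurableSet_Ioc
  · rw [uIoc_of_le ht.1]
    filter_upwards [ae_restrict_mem measurableSet_Ioc] with x hx
    rw [norm_div, div_eq_mul_inv]
    gcongr
    · exact hC _ (mapsTo_sub ht.2 (Ioc_subset_Icc_self hx))
    · exact h.norm_inv_tip_le ht.2 hx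

theorem tipIntegral_linear (h : IsDrift β T K) (ht : t ∈ Icc 0 T) {k₁ k₂ : ℝ → ℂ}
    (hk₁ : ContinuousOn k₁ (Icc 0 T)) (hk₂ : ContinuousOn k₂ (Icc 0 T)) {c : ℂ}
    (hk : ∀ s ∈ Icc 0 T, k s = c * (k₁ s + k₂ s)) :
    tipIntegral β k t = c * (tipIntegral β k₁ t + tipIntegral β k₂ t) := by
  unfold tipIntegral
  rw [← intervalIntegral.integral_add (h.intervalIntegrable_div_tip ht hk₁)
    (h.intervalIntegrable_div_tip ht hk₂), ← intervalIntegral.integral_const_mul]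
  refine intervalIntegral.integral_congr fun x hx => ?_
  rw [uIcc_of_le ht.1] at hx
  simp only [hk _ (mapsTo_sub ht.2 hx)]
  ring

end IsDrift

/-! ### Properties of the driving function of SLE₀(ρ) -/

theorem Icc_subset_halfOpen {τ : ℝ≥0∞} {T : ℝ} (hT : ENNReal.ofReal T < τ) :
    Icc 0 T ⊆ halfOpen τ :=
  fun _ hs => ⟨hs.1, (ENNReal.ofReal_le_ofReal hs.2).trans_lt hT⟩

theorem exists_gt_of_mem_halfOpen {τ : ℝ≥0∞} {t : ℝ} (ht : t ∈ halfOpen τ) :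
    ∃ T, t < T ∧ T ∈ halfOpen τ := by
  obtain ⟨c, hc1, hc2⟩ := exists_between ht.2
  have hc : c ≠ ⊤ := hc2.ne_top
  have h1 : t < c.toReal := (ENNReal.ofReal_lt_iff_lt_toReal ht.1 hc).1 hc1
  exact ⟨c.toReal, h1, ht.1.trans h1.le, by rwa [ENNReal.ofReal_toReal hc]⟩

theorem halfOpen_mem_nhdsWithin {τ : ℝ≥0∞} {t T : ℝ} (ht : t < T) :
    Icc 0 T ∈ 𝓝[halfOpen τ] t := by
  filter_upwards [self_mem_nhdsWithin, nhdsWithin_le_nhds (gt_mem_nhds ht)] with s hs hsT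
  exact ⟨hs.1, le_of_lt hsT⟩

theorem isOpen_openInterval (τ : ℝ≥0∞) : IsOpen (openInterval τ) :=
  isOpen_Ioi.inter (isOpen_Iio.preimage ENNReal.continuous_ofReal)

theorem openInterval_subset_halfOpen (τ : ℝ≥0∞) : openInterval τ ⊆ halfOpen τ :=
  fun _ h => ⟨h.1.le, h.2⟩

theorem continuousOn_halfOpen {E : Type*} [TopologicalSpace E] {τ : ℝ≥0∞} {f : ℝ → E}
    (h : ∀ T ∈ halfOpen τ, ContinuousOn f (Icc 0 T)) : ContinuousOn f (halfOpen τ) := by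
  intro t ht
  obtain ⟨T, htT, hT⟩ := exists_gt_of_mem_halfOpen ht
  exact (h T hT t ⟨ht.1, htT.le⟩).mono_of_mem_nhdsWithin (halfOpen_mem_nhdsWithin htT)

/-- The drift of the driving function. -/
def driftFun (ρ : ℝ) (W : ℝ → ℝ) (Z : ℝ → ℂ) (s : ℝ) : ℝ := ((ρ : ℂ) / ((W s : ℂ) - Z s)).re

/-- Writing the real part as half the sum with the conjugate expresses the drift through the two
coefficients `2/A` and `2/conj A` whose integrals are logarithmic increments. -/
theorem driftFun_eq (ρ : ℝ) (W : ℝ → ℝ) (Z : ℝ → ℂ) (s : ℝ) : (driftFun ρ W Z s : ℂ) =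
    -((ρ : ℂ) / 4) * (2 / (Z s - W s) + 2 / (starRingEnd ℂ) (Z s - W s)) := by
  rw [driftFun, Complex.re_eq_add_conj]
  have : (W s : ℂ) - Z s = -(Z s - W s) := by ring
  rw [this, map_div₀, map_neg, Complex.conj_ofReal, div_neg, div_neg]
  ring

namespace IsSLEZeroDriving

variable {ρ : ℝ} {z₀ : ℂ} {τ : ℝ≥0∞} {W : ℝ → ℝ} {Z : ℝ → ℂ} {T : ℝ}

theorem sub_ne_zero (h : IsSLEZeroDriving ρ z₀ τ W Z) {s : ℝ} (hs : s ∈ halfOpen τ) :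
    Z s - W s ≠ 0 := _root_.sub_ne_zero.2 (h.forcePoint.ne_driving s hs)

theorem sub_zero_eq (h : IsSLEZeroDriving ρ z₀ τ W Z) : Z 0 - W 0 = z₀ := by
  rw [h.initial, h.forcePoint.initial]
  simp

theorem hasDeriv_sub (h : IsSLEZeroDriving ρ z₀ τ W Z) {s : ℝ} (hs : s ∈ halfOpen τ) :
    HasDerivWithinAt (fun s => Z s - W s) (2 / (Z s - W s) - (driftFun ρ W Z s : ℂ))
      (halfOpen τ) s :=
  (h.forcePoint.hasDeriv s hs).sub (hasDerivWithinAt_ofReal (h.drift s hs))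

theorem continuousOn_sub (h : IsSLEZeroDriving ρ z₀ τ W Z) :
    ContinuousOn (fun s => Z s - W s) (halfOpen τ) :=
  fun _ hs => (h.hasDeriv_sub hs).continuousWithinAt

theorem hasDeriv_conj_sub (h : IsSLEZeroDriving ρ z₀ τ W Z) {s : ℝ} (hs : s ∈ halfOpen τ) :
    HasDerivWithinAt (fun s => (starRingEnd ℂ) (Z s - W s))
      (2 / (starRingEnd ℂ) (Z s - W s) - (driftFun ρ W Z s : ℂ)) (halfOpen τ) s := by
  refine (Complex.conjCLE.toContinuousLinearMap.hasFDerivAt.comp_hasDerivWithinAt s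
    (h.hasDeriv_sub hs)).congr_deriv ?_
  simp [map_ofNat]

theorem exists_isDrift (h : IsSLEZeroDriving ρ z₀ τ W Z) (hT : ENNReal.ofReal T < τ) :
    ∃ K, IsDrift (driftFun ρ W Z) T K := by
  have hc : ContinuousOn (driftFun ρ W Z) (Icc 0 T) := by
    have h1 : ContinuousOn (fun s => (ρ : ℂ) / (-(Z s - W s))) (halfOpen τ) :=
      continuousOn_const.div h.continuousOn_sub.neg fun s hs => neg_ne_zero.2 (h.sub_ne_zero hs)
    refine (Complex.continuous_re.comp_continuousOn (h1.mono (Icc_subset_halfOpen hT))).congr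
      fun s _ => ?_
    simp [driftFun]
  obtain ⟨C, hC⟩ := isCompact_Icc.exists_bound_of_continuousOn hc
  exact ⟨C + 1, hc, fun s hs => (hC s hs).trans_lt (lt_add_one C)⟩

theorem hasDeriv_driving (h : IsSLEZeroDriving ρ z₀ τ W Z) (hT : ENNReal.ofReal T < τ) :
    ∀ s ∈ Icc 0 T, HasDerivWithinAt W (driftFun ρ W Z s) (Icc 0 T) s :=
  fun s hs => (h.drift s (Icc_subset_halfOpen hT hs)).mono (Icc_subset_halfOpen hT)

theorem tendsto_loewnerInv (h : IsSLEZeroDriving ρ z₀ τ W Z) {t : ℝ} (ht : t ∈ halfOpen τ) :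
    Tendsto (fun y : ℝ => loewnerInv W t ((W t : ℂ) + (y : ℂ) * Complex.I))
      (𝓝[>] 0) (𝓝 (tip (driftFun ρ W Z) t t)) := by
  obtain ⟨K, hK⟩ := h.exists_isDrift ht.2
  have := hK.tendsto_loewnerInv ⟨ht.1, le_rfl⟩ (h.hasDeriv_driving ht.2)
  simpa [h.initial] using this

/-- The drift is real, so `Im(Z - W)` solves a homogeneous linear equation with coefficient `-2/|Z -
W|²`: its sign, or its vanishing, persists. -/
theorem im_sub_eq (h : IsSLEZeroDriving ρ z₀ τ W Z) {t : ℝ} (ht : t ∈ halfOpen τ) :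
    ∃ c : ℝ, 0 < c ∧ (Z t - W t).im = z₀.im * c := by
  have hsub := Icc_subset_halfOpen ht.2
  have hc : ContinuousOn (fun s => ((-2 / Complex.normSq (Z s - W s) : ℝ) : ℂ)) (Icc 0 t) := by
    refine Complex.continuous_ofReal.comp_continuousOn (continuousOn_const.div
      (Complex.continuous_normSq.comp_continuousOn (h.continuousOn_sub.mono hsub)) fun s hs => ?_)
    exact (Complex.normSq_pos.2 (h.sub_ne_zero (hsub hs))).ne'
  have := eq_mul_exp_integral (f := fun s => (((Z s - W s).im : ℝ) : ℂ)) hc (fun s hs => by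
    refine (hasDerivWithinAt_ofReal (hasDerivWithinAt_im
      ((h.hasDeriv_sub (hsub hs)).mono hsub))).congr_deriv ?_
    rw [← Complex.ofReal_mul]
    congr 1
    simp [Complex.div_im]
    ring) ⟨ht.1, le_rfl⟩
  rw [h.sub_zero_eq, intervalIntegral.integral_ofReal, ← Complex.ofReal_exp,
    ← Complex.ofReal_mul] at this
  exact ⟨_, Real.exp_pos _, Complex.ofReal_injective this⟩

end IsSLEZeroDriving

/-! ### Arc length -/

theorem eVariationOn_inter_Icc_le {f : ℝ → ℂ} {P : ℝ → ℝ} {s : Set ℝ} {a b : ℝ} (ha : a ∈ s)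
    (hb : b ∈ s) (hab : a ≤ b)
    (h : ∀ x ∈ s ∩ Icc a b, ∀ y ∈ s ∩ Icc a b, x ≤ y → ‖f y - f x‖ ≤ P y - P x) :
    eVariationOn f (s ∩ Icc a b) ≤ ENNReal.ofReal (P b - P a) := by
  have hmono : MonotoneOn P (s ∩ Icc a b) := fun x hx y hy hxy =>
    sub_nonneg.1 ((norm_nonneg _).trans (h x hx y hy hxy))
  have := hmono.eVariationOn_eq ⟨ha, le_rfl, hab⟩ ⟨hb, hab, le_rfl⟩
  rw [inter_assoc, inter_self] at this
  rw [← this]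
  refine iSup_le ?_
  rintro ⟨n, u, hu, us⟩
  refine le_trans (Finset.sum_le_sum fun i _ => ?_) (eVariationOn.sum_le (n := n) hu us)
  rw [edist_dist, edist_dist, dist_eq_norm, Real.dist_eq]
  exact ENNReal.ofReal_le_ofReal
    ((h _ (us i) _ (us (i + 1)) (hu (Nat.le_succ i))).trans (le_abs_self _))

theorem zero_mem_halfOpen {τ : ℝ≥0∞} (hτ : 0 < τ) : (0 : ℝ) ∈ halfOpen τ :=
  ⟨le_rfl, by simpa using hτ⟩

theorem ordConnected_halfOpen (τ : ℝ≥0∞) : OrdConnected (halfOpen τ) :=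
  ⟨fun _ ha _ hb _ hc =>
    ⟨ha.1.trans hc.1, (ENNReal.ofReal_le_ofReal hc.2).trans_lt hb.2⟩⟩

/-- A curve with a continuous non-vanishing velocity at positive times, which moves near time `0`
at most as fast as the square root. -/
structure IsRegularCurve (τ : ℝ≥0∞) (γ γ' : ℝ → ℂ) : Prop where
  lifetime_pos : 0 < τ
  norm_sub_le : ∀ T ∈ halfOpen τ, ∃ C : ℝ, 0 ≤ C ∧
    ∀ t₁ t₂, 0 ≤ t₁ → t₁ ≤ t₂ → t₂ ≤ T → ‖γ t₂ - γ t₁‖ ≤ C * (√t₂ - √t₁)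
  hasDeriv : ∀ t ∈ openInterval τ, HasDerivAt γ (γ' t) t
  velocity_ne_zero : ∀ t ∈ openInterval τ, γ' t ≠ 0
  continuousOn_velocity : ContinuousOn γ' (openInterval τ)

/-- The length of `γ` on `[0, t]`. -/
def arcLength (τ : ℝ≥0∞) (γ : ℝ → ℂ) (t : ℝ) : ℝ := variationOnFromTo γ (halfOpen τ) 0 t

/-- The time at which the arc of `γ` from `γ 0` has length `s`. -/
def arcTime (τ : ℝ≥0∞) (γ : ℝ → ℂ) (s : ℝ) : ℝ :=
  @Function.invFunOn _ _ ⟨0⟩ (arcLength τ γ) (halfOpen τ) s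

theorem arcLengthParam_eq (τ : ℝ≥0∞) (γ : ℝ → ℂ) : arcLengthParam τ γ = γ ∘ arcTime τ γ := rfl

theorem arcLength_zero (τ : ℝ≥0∞) (γ : ℝ → ℂ) : arcLength τ γ 0 = 0 := variationOnFromTo.self _ _ _

namespace IsRegularCurve

variable {τ : ℝ≥0∞} {γ γ' : ℝ → ℂ}

theorem exists_eVariationOn_le (h : IsRegularCurve τ γ γ') {T : ℝ} (hT : T ∈ halfOpen τ) :
    ∃ C : ℝ, 0 ≤ C ∧ ∀ a b, 0 ≤ a → a ≤ b → b ≤ T →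
      eVariationOn γ (halfOpen τ ∩ Icc a b) ≤ ENNReal.ofReal (C * √b - C * √a) := by
  obtain ⟨C, hC0, hC⟩ := h.norm_sub_le T hT
  refine ⟨C, hC0, fun a b ha hab hb => ?_⟩
  refine eVariationOn_inter_Icc_le (P := fun x => C * √x)
    (Icc_subset_halfOpen hT.2 ⟨ha, hab.trans hb⟩) (Icc_subset_halfOpen hT.2 ⟨ha.trans hab, hb⟩)
    hab fun x hx y hy hxy => ?_
  rw [← mul_sub]
  exact hC x y hx.1.1 hxy (hy.2.2.trans hb)

theorem locallyBoundedVariationOn (h : IsRegularCurve τ γ γ') :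
    LocallyBoundedVariationOn γ (halfOpen τ) := by
  intro a b ha hb
  rcases le_total a b with hab | hab
  · obtain ⟨C, -, hC⟩ := h.exists_eVariationOn_le hb
    exact ne_top_of_le_ne_top ENNReal.ofReal_ne_top (hC a b ha.1 hab le_rfl)
  · rw [BoundedVariationOn, eVariationOn.subsingleton]
    · exact ENNReal.zero_ne_top
    · intro x hx y hy
      have h1 := hx.2.1
      have h2 := hx.2.2
      have h3 := hy.2.1
      have h4 := hy.2.2
      linarith

theorem arcLength_sub (h : IsRegularCurve τ γ γ') {a b : ℝ} (ha : a ∈ halfOpen τ)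
    (hb : b ∈ halfOpen τ) (hab : a ≤ b) : arcLength τ γ b - arcLength τ γ a =
      (eVariationOn γ (halfOpen τ ∩ Icc a b)).toReal := by
  rw [arcLength, arcLength, variationOnFromTo.sub_right h.locallyBoundedVariationOn
    (zero_mem_halfOpen h.lifetime_pos) hb ha, variationOnFromTo.eq_of_le _ _ hab]

theorem norm_sub_le_arcLength (h : IsRegularCurve τ γ γ') {a b : ℝ} (ha : a ∈ halfOpen τ)
    (hb : b ∈ halfOpen τ) (hab : a ≤ b) :
    ‖γ b - γ a‖ ≤ arcLength τ γ b - arcLength τ γ a := by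
  rw [h.arcLength_sub ha hb hab, ← dist_eq_norm, dist_edist]
  exact ENNReal.toReal_mono (h.locallyBoundedVariationOn a b ha hb)
    (eVariationOn.edist_le γ ⟨hb, hab, le_rfl⟩ ⟨ha, le_rfl, hab⟩)

theorem arcLength_sub_le (h : IsRegularCurve τ γ γ') {P : ℝ → ℝ} {a b : ℝ} (ha : a ∈ halfOpen τ)
    (hb : b ∈ halfOpen τ) (hab : a ≤ b)
    (hP : ∀ x ∈ halfOpen τ ∩ Icc a b, ∀ y ∈ halfOpen τ ∩ Icc a b, x ≤ y →
      ‖γ y - γ x‖ ≤ P y - P x) : arcLength τ γ b - arcLength τ γ a ≤ P b - P a := by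
  rw [h.arcLength_sub ha hb hab]
  refine ENNReal.toReal_le_of_le_ofReal ?_ (eVariationOn_inter_Icc_le ha hb hab hP)
  exact (norm_nonneg _).trans (hP a ⟨ha, le_rfl, hab⟩ b ⟨hb, hab, le_rfl⟩ hab)

theorem monotoneOn_arcLength (h : IsRegularCurve τ γ γ') :
    MonotoneOn (arcLength τ γ) (halfOpen τ) := fun _ ha _ hb hab =>
  sub_nonneg.1 ((norm_nonneg _).trans (h.norm_sub_le_arcLength ha hb hab))

theorem continuousOn_arcLength (h : IsRegularCurve τ γ γ') :
    ContinuousOn (arcLength τ γ) (halfOpen τ) := by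
  refine continuousOn_halfOpen fun T hT t ht => ?_
  obtain ⟨C, hC0, hC⟩ := h.norm_sub_le T hT
  have hsub := Icc_subset_halfOpen hT.2
  have hle : ∀ a b, 0 ≤ a → a ≤ b → b ≤ T →
      |arcLength τ γ b - arcLength τ γ a| ≤ |C * √b - C * √a| := fun a b ha hab hb => by
    rw [abs_of_nonneg (sub_nonneg.2 (h.monotoneOn_arcLength (hsub ⟨ha, hab.trans hb⟩)
      (hsub ⟨ha.trans hab, hb⟩) hab))]
    refine (h.arcLength_sub_le (P := fun x => C * √x) (hsub ⟨ha, hab.trans hb⟩)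
      (hsub ⟨ha.trans hab, hb⟩) hab fun x hx y hy hxy => ?_).trans (le_abs_self _)
    rw [← mul_sub]
    exact hC x y hx.1.1 hxy (hy.2.2.trans hb)
  rw [ContinuousWithinAt, tendsto_iff_norm_sub_tendsto_zero]
  refine squeeze_zero' (Eventually.of_forall fun _ => norm_nonneg _)
    (g := fun s => |C * √s - C * √t|) (eventually_mem_nhdsWithin.mono fun s hs => ?_) ?_
  · rw [Real.norm_eq_abs]
    rcases le_total t s with hts | hts
    · exact hle t s ht.1 hts hs.2
    · rw [abs_sub_comm, abs_sub_comm (C * √s)]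
      exact hle s t hs.1 hts ht.2
  · have : Continuous fun s => |C * √s - C * √t| := by fun_prop
    simpa using (this.tendsto t).mono_left nhdsWithin_le_nhds

theorem hasDerivAt_arcLength (h : IsRegularCurve τ γ γ') {t : ℝ} (ht : t ∈ openInterval τ) :
    HasDerivAt (arcLength τ γ) ‖γ' t‖ t := by
  have hnhds : openInterval τ ∈ 𝓝 t := (isOpen_openInterval τ).mem_nhds ht
  have hstrict : HasStrictDerivAt γ (γ' t) t := hasStrictDerivAt_of_hasDerivAt_of_continuousAt
    (by filter_upwards [hnhds] with s hs using h.hasDeriv s hs)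
    (h.continuousOn_velocity.continuousAt hnhds)
  have hslope : Tendsto (fun s => ‖slope γ t s‖) (𝓝[≠] t) (𝓝 ‖γ' t‖) :=
    (hasDerivAt_iff_tendsto_slope.1 (h.hasDeriv t ht)).norm
  rw [hasDerivAt_iff_tendsto_slope]
  -- Below: the chord is no longer than the arc. Above: by strict differentiability, `γ` is locally
  -- Lipschitz with any constant larger than `‖γ' t‖`, and so is its arc length.
  refine tendsto_order.2 ⟨fun c hc => ?_, fun c hc => ?_⟩
  · filter_upwards [(tendsto_order.1 hslope).1 c hc, nhdsWithin_le_nhds hnhds] with s hs hsm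
    refine hs.trans_le ?_
    rw [slope_def_module, slope_def_module, norm_smul, norm_inv, Real.norm_eq_abs, smul_eq_mul]
    have hs' := openInterval_subset_halfOpen τ hsm
    have ht' := openInterval_subset_halfOpen τ ht
    rcases le_total t s with hts | hts
    · rw [abs_of_nonneg (sub_nonneg.2 hts)]
      exact mul_le_mul_of_nonneg_left (h.norm_sub_le_arcLength ht' hs' hts)
        (inv_nonneg.2 (sub_nonneg.2 hts))
    · rw [abs_sub_comm, abs_of_nonneg (sub_nonneg.2 hts), norm_sub_rev]
      have e : (s - t)⁻¹ * (arcLength τ γ s - arcLength τ γ t) =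
          (t - s)⁻¹ * (arcLength τ γ t - arcLength τ γ s) := by
        rw [← neg_sub t s, inv_neg]
        ring
      rw [e]
      exact mul_le_mul_of_nonneg_left (h.norm_sub_le_arcLength hs' ht' hts)
        (inv_nonneg.2 (sub_nonneg.2 hts))
  · obtain ⟨K, hK1, hK2⟩ := exists_between hc
    have hK0 : 0 ≤ K := (norm_nonneg _).trans hK1.le
    lift K to NNReal using hK0
    obtain ⟨U, hU, hL⟩ := hstrict.hasStrictFDerivAt.exists_lipschitzOnWith_of_nnnorm_lt K (by
      rw [← NNReal.coe_lt_coe, coe_nnnorm]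
      simpa using hK1)
    obtain ⟨δ, hδ, hball⟩ := Metric.mem_nhds_iff.1 (inter_mem hU hnhds)
    rw [Real.ball_eq_Ioo] at hball
    have hle : ∀ a ∈ Ioo (t - δ) (t + δ), ∀ b ∈ Ioo (t - δ) (t + δ), a ≤ b →
        arcLength τ γ b - arcLength τ γ a ≤ K * (b - a) := fun a ha b hb hab => by
      rw [mul_sub]
      refine h.arcLength_sub_le (P := fun x => K * x)
        (openInterval_subset_halfOpen τ (hball ha).2)
        (openInterval_subset_halfOpen τ (hball hb).2) hab fun x hx y hy hxy => ?_
      have hx' : x ∈ U := (hball ⟨ha.1.trans_le hx.2.1, hx.2.2.trans_lt hb.2⟩).1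
      have hy' : y ∈ U := (hball ⟨ha.1.trans_le hy.2.1, hy.2.2.trans_lt hb.2⟩).1
      have := hL.dist_le_mul y hy' x hx'
      rw [dist_eq_norm, Real.dist_eq, abs_of_nonneg (sub_nonneg.2 hxy)] at this
      linarith
    have htm : t ∈ Ioo (t - δ) (t + δ) := ⟨by linarith, by linarith⟩
    filter_upwards [self_mem_nhdsWithin,
      nhdsWithin_le_nhds (Ioo_mem_nhds htm.1 htm.2)] with s hne hs
    refine lt_of_le_of_lt ?_ hK2
    rw [slope_def_field]
    rcases lt_or_gt_of_ne (show s ≠ t from hne) with hlt | hgt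
    · rw [← neg_div_neg_eq, neg_sub, neg_sub, div_le_iff₀ (sub_pos.2 hlt)]
      exact hle s hs t htm hlt.le
    · rw [div_le_iff₀ (sub_pos.2 hgt)]
      exact hle t htm s hs hgt.le

theorem strictMonoOn_arcLength (h : IsRegularCurve τ γ γ') :
    StrictMonoOn (arcLength τ γ) (halfOpen τ) := by
  refine strictMonoOn_of_deriv_pos (ordConnected_halfOpen τ).convex h.continuousOn_arcLength
    fun t ht => ?_
  have ht' : t ∈ openInterval τ := by
    refine ⟨?_, (interior_subset ht).2⟩
    have : t ∈ interior (Ici (0 : ℝ)) := interior_mono (fun s hs => hs.1) ht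
    rwa [interior_Ici] at this
  rw [(h.hasDerivAt_arcLength ht').deriv]
  exact norm_pos_iff.2 (h.velocity_ne_zero t ht')

theorem ofReal_arcLength (h : IsRegularCurve τ γ γ') {t : ℝ} (ht : t ∈ halfOpen τ) :
    ENNReal.ofReal (arcLength τ γ t) = eVariationOn γ (halfOpen τ ∩ Icc 0 t) := by
  rw [arcLength, variationOnFromTo.eq_of_le _ _ ht.1, ENNReal.ofReal_toReal
    (h.locallyBoundedVariationOn 0 t (zero_mem_halfOpen h.lifetime_pos) ht)]

theorem arcLength_nonneg {t : ℝ} (ht : t ∈ halfOpen τ) : 0 ≤ arcLength τ γ t :=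
  variationOnFromTo.nonneg_of_le _ _ ht.1

theorem mapsTo_arcLength (h : IsRegularCurve τ γ γ') :
    MapsTo (arcLength τ γ) (halfOpen τ) (halfOpen (totalLength τ γ)) := by
  intro t ht
  obtain ⟨T, htT, hT⟩ := exists_gt_of_mem_halfOpen ht
  refine ⟨arcLength_nonneg ht, ?_⟩
  have h1 := h.strictMonoOn_arcLength ht hT htT
  calc ENNReal.ofReal (arcLength τ γ t) < ENNReal.ofReal (arcLength τ γ T) :=
        (ENNReal.ofReal_lt_ofReal_iff_of_nonneg (arcLength_nonneg ht)).2 h1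
    _ ≤ totalLength τ γ := by
        rw [h.ofReal_arcLength hT]
        exact eVariationOn.mono _ inter_subset_left

theorem surjOn_arcLength (h : IsRegularCurve τ γ γ') :
    SurjOn (arcLength τ γ) (halfOpen τ) (halfOpen (totalLength τ γ)) := by
  intro s hs
  have h1 := hs.2
  -- The total length is a supremum over compact pieces, so `s` lies below the length of one of them
  -- and the intermediate value theorem applies.
  rw [totalLength, eVariationOn.eq_biSup_inter_Icc] at h1
  simp only [lt_iSup_iff] at h1
  obtain ⟨⟨a, b⟩, ⟨ha, hb, hab⟩, h1⟩ := h1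
  have h2 : s ≤ arcLength τ γ b := by
    rw [← ENNReal.ofReal_le_ofReal_iff (arcLength_nonneg hb), h.ofReal_arcLength hb]
    exact h1.le.trans (eVariationOn.mono _
      (inter_subset_inter_right _ (Icc_subset_Icc_left ha.1)))
  have hsub := Icc_subset_halfOpen hb.2
  obtain ⟨t, ht, rfl⟩ := intermediate_value_Icc hb.1 (h.continuousOn_arcLength.mono hsub)
    ⟨(arcLength_zero τ γ).le.trans hs.1, h2⟩
  exact ⟨t, hsub ht, rfl⟩

theorem image_arcLength (h : IsRegularCurve τ γ γ') :
    arcLength τ γ '' halfOpen τ = halfOpen (totalLength τ γ) :=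
  h.mapsTo_arcLength.image_subset.antisymm h.surjOn_arcLength

theorem arcTime_mem (h : IsRegularCurve τ γ γ') {s : ℝ} (hs : s ∈ halfOpen (totalLength τ γ)) :
    arcTime τ γ s ∈ halfOpen τ := Function.invFunOn_mem (h.surjOn_arcLength hs)

theorem arcLength_arcTime (h : IsRegularCurve τ γ γ') {s : ℝ}
    (hs : s ∈ halfOpen (totalLength τ γ)) : arcLength τ γ (arcTime τ γ s) = s :=
  Function.invFunOn_eq (h.surjOn_arcLength hs)

theorem totalLength_pos (h : IsRegularCurve τ γ γ') : 0 < totalLength τ γ := by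
  have := (h.mapsTo_arcLength (zero_mem_halfOpen h.lifetime_pos)).2
  rwa [arcLength_zero, ENNReal.ofReal_zero] at this

theorem arcTime_zero (h : IsRegularCurve τ γ γ') : arcTime τ γ 0 = 0 := by
  have h0 := zero_mem_halfOpen h.totalLength_pos
  refine h.strictMonoOn_arcLength.injOn (h.arcTime_mem h0) (zero_mem_halfOpen h.lifetime_pos) ?_
  rw [h.arcLength_arcTime h0, arcLength_zero]

theorem arcTime_mem_openInterval (h : IsRegularCurve τ γ γ') {s : ℝ}
    (hs : s ∈ openInterval (totalLength τ γ)) : arcTime τ γ s ∈ openInterval τ := by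
  have hs' := openInterval_subset_halfOpen _ hs
  have h1 := h.arcTime_mem hs'
  refine ⟨lt_of_le_of_ne h1.1 fun h0 => ?_, h1.2⟩
  have h2 := h.arcLength_arcTime hs'
  rw [← h0, arcLength_zero] at h2
  exact hs.1.ne h2

/-- A monotone map onto an interval has no jumps. -/
theorem continuousOn_arcTime (h : IsRegularCurve τ γ γ') :
    ContinuousOn (arcTime τ γ) (halfOpen (totalLength τ γ)) := by
  have := ordConnected_halfOpen τ
  have := ordConnected_halfOpen (totalLength τ γ)
  let f : halfOpen (totalLength τ γ) → halfOpen τ := fun s => ⟨arcTime τ γ s, h.arcTime_mem s.2⟩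
  have hmono : Monotone f := fun a b hab => by
    refine Subtype.mk_le_mk.2 ?_
    rw [← h.strictMonoOn_arcLength.le_iff_le (h.arcTime_mem a.2) (h.arcTime_mem b.2),
      h.arcLength_arcTime a.2, h.arcLength_arcTime b.2]
    exact hab
  have hsurj : Function.Surjective f := fun t => by
    have hm := h.mapsTo_arcLength t.2
    refine ⟨⟨arcLength τ γ t, hm⟩, Subtype.ext ?_⟩
    exact h.strictMonoOn_arcLength.injOn (h.arcTime_mem hm) t.2 (h.arcLength_arcTime hm)
  rw [continuousOn_iff_continuous_domRestrict]
  exact continuous_subtype_val.comp (hmono.continuous_of_surjective hsurj)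

theorem hasDerivAt_arcTime (h : IsRegularCurve τ γ γ') {s : ℝ}
    (hs : s ∈ openInterval (totalLength τ γ)) :
    HasDerivAt (arcTime τ γ) ‖γ' (arcTime τ γ s)‖⁻¹ s := by
  have hn := (isOpen_openInterval _).mem_nhds hs
  have hm := h.arcTime_mem_openInterval hs
  refine HasDerivAt.of_local_left_inverse ((h.continuousOn_arcTime.mono
    (openInterval_subset_halfOpen _)).continuousAt hn) (h.hasDerivAt_arcLength hm)
    (norm_ne_zero_iff.2 (h.velocity_ne_zero _ hm)) ?_
  filter_upwards [hn] with x hx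
  exact h.arcLength_arcTime (openInterval_subset_halfOpen _ hx)

theorem hasDerivAt_arcLengthParam (h : IsRegularCurve τ γ γ') {s : ℝ}
    (hs : s ∈ openInterval (totalLength τ γ)) :
    HasDerivAt (arcLengthParam τ γ) (γ' (arcTime τ γ s) / ‖γ' (arcTime τ γ s)‖) s := by
  have hm := h.arcTime_mem_openInterval hs
  refine ((h.hasDeriv _ hm).scomp s (h.hasDerivAt_arcTime hs)).congr_deriv ?_
  rw [Complex.real_smul, Complex.ofReal_inv, div_eq_inv_mul]

theorem contDiffOn_arcLengthParam (h : IsRegularCurve τ γ γ') :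
    ContDiffOn ℝ 1 (arcLengthParam τ γ) (openInterval (totalLength τ γ)) := by
  have ho := isOpen_openInterval (totalLength τ γ)
  rw [contDiffOn_one_iff_derivWithin ho.uniqueDiffOn]
  refine ⟨fun s hs => (h.hasDerivAt_arcLengthParam hs).differentiableAt.differentiableWithinAt, ?_⟩
  have hc : ContinuousOn (fun s => γ' (arcTime τ γ s)) (openInterval (totalLength τ γ)) :=
    h.continuousOn_velocity.comp (h.continuousOn_arcTime.mono (openInterval_subset_halfOpen _))
      fun s hs => h.arcTime_mem_openInterval hs
  refine ContinuousOn.congr (f := fun s => γ' (arcTime τ γ s) / ‖γ' (arcTime τ γ s)‖)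
    (hc.div (Complex.continuous_ofReal.comp_continuousOn hc.norm) fun s hs => ?_) fun s hs => ?_
  · simpa using h.velocity_ne_zero _ (h.arcTime_mem_openInterval hs)
  · rw [derivWithin_of_isOpen ho hs, (h.hasDerivAt_arcLengthParam hs).deriv]

theorem hasUnitSpeedOn_arcLengthParam (h : IsRegularCurve τ γ γ') :
    HasUnitSpeedOn (arcLengthParam τ γ) (openInterval (totalLength τ γ)) := by
  have := has_unit_speed_naturalParameterization γ h.locallyBoundedVariationOn
    (zero_mem_halfOpen h.lifetime_pos)
  change HasUnitSpeedOn (arcLengthParam τ γ) (arcLength τ γ '' halfOpen τ) at this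
  rw [h.image_arcLength] at this
  intro x hx y hy
  rw [← this (openInterval_subset_halfOpen _ hx) (openInterval_subset_halfOpen _ hy)]
  congr 1
  ext z
  exact ⟨fun hz => ⟨openInterval_subset_halfOpen _ hz.1, hz.2⟩,
    fun hz => ⟨⟨lt_of_lt_of_le hx.1 hz.2.1, hz.1.2⟩, hz.2⟩⟩

end IsRegularCurve

/-! ### Existence of the driving function -/

/-- The position of the force point relative to the driving function, in the time scale in which
the equation is linear. -/
def relPos (ρ : ℝ) (z₀ : ℂ) (s : ℝ) : ℂ :=
  ⟨z₀.re * Real.exp ((2 + ρ) * s), z₀.im * Real.exp (-2 * s)⟩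

/-- The half-plane capacity time as a function of the linear time scale. -/
def clock (ρ : ℝ) (z₀ : ℂ) (s : ℝ) : ℝ := ∫ x in 0..s, Complex.normSq (relPos ρ z₀ x)

/-- The inverse of `clock`. -/
def clockInv (ρ : ℝ) (z₀ : ℂ) : ℝ → ℝ := Function.invFun (clock ρ z₀)

/-- The lifetime of SLE₀(ρ). -/
def lifetime (ρ : ℝ) (z₀ : ℂ) : ℝ≥0∞ := ⨆ s : ℝ, ENNReal.ofReal (clock ρ z₀ s)

/-- The driving function of SLE₀(ρ). -/
def driving (ρ : ℝ) (z₀ : ℂ) (t : ℝ) : ℝ :=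
  ∫ x in 0..clockInv ρ z₀ t, -ρ * (relPos ρ z₀ x).re

/-- The evolution of the force point of SLE₀(ρ). -/
def forcePoint (ρ : ℝ) (z₀ : ℂ) (t : ℝ) : ℂ :=
  relPos ρ z₀ (clockInv ρ z₀ t) + driving ρ z₀ t

section

variable {ρ : ℝ} {z₀ : ℂ}

theorem relPos_zero : relPos ρ z₀ 0 = z₀ := by
  apply Complex.ext <;> simp [relPos]

theorem relPos_ne_zero (hz : z₀ ≠ 0) (s : ℝ) : relPos ρ z₀ s ≠ 0 := fun h => by
  have h1 := congrArg Complex.re h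
  have h2 := congrArg Complex.im h
  simp only [relPos, Complex.zero_re, Complex.zero_im, mul_eq_zero, Real.exp_ne_zero,
    or_false] at h1 h2
  exact hz (Complex.ext h1 h2)

theorem relPos_eq (s : ℝ) : relPos ρ z₀ s =
    (z₀.re * Real.exp ((2 + ρ) * s) : ℝ) + (z₀.im * Real.exp (-2 * s) : ℝ) * Complex.I :=
  Complex.mk_eq_add_mul_I _ _

/-- Under `dt = |A|² ds` the equation `dA/dt = 2/A + ρ Re A/|A|²` becomes `dA/ds = 2 conj A + ρ Re
A`, which is diagonal in the real and imaginary parts with rates `2 + ρ` and `-2`. -/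
theorem hasDerivAt_relPos (s : ℝ) : HasDerivAt (relPos ρ z₀)
    (((2 + ρ) * (relPos ρ z₀ s).re : ℝ) + (-2 * (relPos ρ z₀ s).im : ℝ) * Complex.I) s := by
  have h1 : ∀ c d : ℝ, HasDerivAt (fun s => ((d * Real.exp (c * s) : ℝ) : ℂ))
      ((c * (d * Real.exp (c * s)) : ℝ) : ℂ) s := fun c d => by
    have := ((((hasDerivAt_id s).const_mul c).exp).const_mul d).ofReal_comp
    refine this.congr_deriv ?_
    simp only [id, mul_one]
    push_cast
    ring
  have h2 := (h1 (2 + ρ) z₀.re).add ((h1 (-2) z₀.im).mul_const Complex.I)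
  exact h2.congr_of_eventuallyEq (Eventually.of_forall fun s => relPos_eq s)

theorem continuous_relPos : Continuous (relPos ρ z₀) :=
  continuous_iff_continuousAt.2 fun s => (hasDerivAt_relPos s).continuousAt

theorem continuous_normSq_relPos : Continuous fun s => Complex.normSq (relPos ρ z₀ s) :=
  Complex.continuous_normSq.comp continuous_relPos

theorem hasStrictDerivAt_clock (s : ℝ) :
    HasStrictDerivAt (clock ρ z₀) (Complex.normSq (relPos ρ z₀ s)) s :=
  continuous_normSq_relPos.integral_hasStrictDerivAt 0 s

theorem strictMono_clock (hz : z₀ ≠ 0) : StrictMono (clock ρ z₀) :=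
  strictMono_of_hasDerivAt_pos (fun s => (hasStrictDerivAt_clock s).hasDerivAt)
    fun s => Complex.normSq_pos.2 (relPos_ne_zero hz s)

theorem continuous_clock : Continuous (clock ρ z₀) :=
  continuous_iff_continuousAt.2 fun s => (hasStrictDerivAt_clock s).hasDerivAt.continuousAt

theorem clock_zero : clock ρ z₀ 0 = 0 := intervalIntegral.integral_same

theorem clockInv_clock (hz : z₀ ≠ 0) (s : ℝ) : clockInv ρ z₀ (clock ρ z₀ s) = s :=
  Function.leftInverse_invFun (strictMono_clock hz).injective s

theorem clockInv_zero (hz : z₀ ≠ 0) : clockInv ρ z₀ 0 = 0 := by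
  have := clockInv_clock (ρ := ρ) hz 0
  rwa [clock_zero] at this

theorem hasDerivAt_clockInv (hz : z₀ ≠ 0) (s : ℝ) :
    HasDerivAt (clockInv ρ z₀) (Complex.normSq (relPos ρ z₀ s))⁻¹ (clock ρ z₀ s) :=
  ((hasStrictDerivAt_clock s).to_local_left_inverse
    (Complex.normSq_pos.2 (relPos_ne_zero hz s)).ne'
    (Eventually.of_forall fun x => clockInv_clock hz x)).hasDerivAt

theorem clock_nonneg (hz : z₀ ≠ 0) {s : ℝ} (hs : 0 ≤ s) : 0 ≤ clock ρ z₀ s := by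
  have := (strictMono_clock (ρ := ρ) hz).monotone hs
  rwa [clock_zero] at this

theorem exists_clock_eq (hz : z₀ ≠ 0) {t : ℝ} (ht : t ∈ halfOpen (lifetime ρ z₀)) :
    ∃ s, 0 ≤ s ∧ clock ρ z₀ s = t := by
  obtain ⟨S, hS⟩ := lt_iSup_iff.1 ht.2
  have h1 : t < clock ρ z₀ S := lt_of_not_ge fun hle =>
    absurd hS (not_lt.2 (ENNReal.ofReal_le_ofReal hle))
  have h2 : 0 ≤ S := by
    rw [← (strictMono_clock (ρ := ρ) hz).le_iff_le, clock_zero]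
    exact ht.1.trans h1.le
  obtain ⟨s, hs, rfl⟩ := intermediate_value_Icc h2 continuous_clock.continuousOn
    ⟨clock_zero.le.trans ht.1, h1.le⟩
  exact ⟨s, hs.1, rfl⟩

theorem clock_mem_halfOpen (hz : z₀ ≠ 0) {s : ℝ} (hs : 0 ≤ s) :
    clock ρ z₀ s ∈ halfOpen (lifetime ρ z₀) := by
  refine ⟨clock_nonneg hz hs, ?_⟩
  have h1 := strictMono_clock (ρ := ρ) hz (lt_add_one s)
  refine lt_of_lt_of_le ?_ (le_iSup (fun s => ENNReal.ofReal (clock ρ z₀ s)) (s + 1))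
  exact (ENNReal.ofReal_lt_ofReal_iff_of_nonneg (clock_nonneg hz hs)).2 h1

theorem lifetime_pos (hz : z₀ ≠ 0) : 0 < lifetime ρ z₀ := by
  have := (clock_mem_halfOpen (ρ := ρ) hz le_rfl).2
  rwa [clock_zero, ENNReal.ofReal_zero] at this

theorem forcePoint_sub (t : ℝ) :
    forcePoint ρ z₀ t - driving ρ z₀ t = relPos ρ z₀ (clockInv ρ z₀ t) := by
  simp [forcePoint]

theorem hasDerivAt_driving (hz : z₀ ≠ 0) {t : ℝ} (ht : t ∈ halfOpen (lifetime ρ z₀)) :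
    HasDerivAt (driving ρ z₀) ((ρ : ℂ) / ((driving ρ z₀ t : ℂ) - forcePoint ρ z₀ t)).re t := by
  have hc : Continuous fun x => -ρ * (relPos ρ z₀ x).re :=
    continuous_const.mul (Complex.continuous_re.comp continuous_relPos)
  have e : (driving ρ z₀ t : ℂ) - forcePoint ρ z₀ t = -relPos ρ z₀ (clockInv ρ z₀ t) := by
    rw [← forcePoint_sub, neg_sub]
  rw [e]
  obtain ⟨s, -, rfl⟩ := exists_clock_eq hz ht
  refine (((hc.integral_hasStrictDerivAt 0 _).hasDerivAt).comp _
    (hasDerivAt_clockInv hz s)).congr_deriv ?_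
  rw [clockInv_clock hz, Complex.div_re]
  simp
  ring

theorem hasDerivAt_forcePoint (hz : z₀ ≠ 0) {t : ℝ} (ht : t ∈ halfOpen (lifetime ρ z₀)) :
    HasDerivAt (forcePoint ρ z₀) (2 / (forcePoint ρ z₀ t - driving ρ z₀ t)) t := by
  have h1 := (hasDerivAt_driving hz ht).ofReal_comp
  have e : (driving ρ z₀ t : ℂ) - forcePoint ρ z₀ t = -relPos ρ z₀ (clockInv ρ z₀ t) := by
    rw [← forcePoint_sub, neg_sub]
  rw [e] at h1
  rw [forcePoint_sub]
  obtain ⟨s, -, rfl⟩ := exists_clock_eq hz ht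
  refine (((hasDerivAt_relPos (clockInv ρ z₀ (clock ρ z₀ s))).scomp _
    (hasDerivAt_clockInv hz s)).add h1).congr_deriv ?_
  rw [clockInv_clock hz]
  have hn := (Complex.normSq_pos.2 (relPos_ne_zero (ρ := ρ) hz s)).ne'
  apply Complex.ext
  · simp [Complex.div_re]
    field_simp
    ring
  · simp [Complex.div_im]
    field_simp

theorem norm_driving_sub (t : ℝ) :
    ‖(driving ρ z₀ t : ℂ) - forcePoint ρ z₀ t‖ = ‖relPos ρ z₀ (clockInv ρ z₀ t)‖ := by
  rw [norm_sub_rev, forcePoint_sub]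

/-- Before any fixed clock time the distance to the force point is bounded below, so small `ε` are
reached only later. If the lifetime is finite, every small `ε` is reached: a distance staying at
least `ε` would make the clock grow at rate at least `ε²` forever. An infinite lifetime needs no
upper estimate. -/
theorem tendsto_approachTime (hz : z₀ ≠ 0) :
    Tendsto (approachTime (lifetime ρ z₀) (driving ρ z₀) (forcePoint ρ z₀)) (𝓝[>] 0)
      (𝓝 (lifetime ρ z₀)) := by
  refine tendsto_order.2 ⟨fun a ha => ?_, fun a ha => ?_⟩
  · obtain ⟨S, hS⟩ := lt_iSup_iff.1 ha
    have hS0 : 0 ≤ S := by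
      by_contra hneg
      have h1 := strictMono_clock (ρ := ρ) hz (not_le.1 hneg)
      rw [clock_zero] at h1
      rw [ENNReal.ofReal_of_nonpos h1.le] at hS
      exact not_lt_zero hS
    obtain ⟨x, -, hx⟩ := isCompact_Icc.exists_isMinOn (nonempty_Icc.2 hS0)
      (continuous_relPos (ρ := ρ) (z₀ := z₀)).norm.continuousOn
    filter_upwards [Ioo_mem_nhdsGT (norm_pos_iff.2 (relPos_ne_zero (ρ := ρ) hz x))] with ε hε
    refine hS.trans_le (le_sInf ?_)
    rintro _ ⟨t, ⟨ht, hte⟩, rfl⟩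
    refine ENNReal.ofReal_le_ofReal (le_of_not_gt fun hlt => ?_)
    obtain ⟨s, hs0, rfl⟩ := exists_clock_eq hz (openInterval_subset_halfOpen _ ht)
    rw [norm_driving_sub, clockInv_clock hz] at hte
    have hsS := (strictMono_clock (ρ := ρ) hz).lt_iff_lt.1 hlt
    have := hx ⟨hs0, hsS.le⟩
    simp only [mem_ofPred_eq] at this
    linarith [hε.2]
  · have hfin : lifetime ρ z₀ ≠ ⊤ := ha.ne_top
    filter_upwards [Ioo_mem_nhdsGT (norm_pos_iff.2 hz)] with ε hε
    obtain ⟨s, hs0, hs⟩ : ∃ s, 0 ≤ s ∧ ‖relPos ρ z₀ s‖ < ε := by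
      by_contra! hcon
      -- Chosen so that `ε² S` exceeds the lifetime by one.
      set S := ((lifetime ρ z₀).toReal + 1) / ε ^ 2 with hS
      have hεp := hε.1
      have hS0 : 0 ≤ S := by positivity
      have h1 : ε ^ 2 * S ≤ clock ρ z₀ S := by
        have := intervalIntegral.integral_mono_on (μ := volume) hS0
          (intervalIntegrable_const (c := ε ^ 2))
          ((continuous_normSq_relPos (ρ := ρ) (z₀ := z₀)).intervalIntegrable 0 S)
          fun x hx => by
            rw [Complex.normSq_eq_norm_sq]
            exact pow_le_pow_left₀ hε.1.le (hcon x hx.1) 2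
        rw [intervalIntegral.integral_const, smul_eq_mul, sub_zero, mul_comm] at this
        exact this
      have h2 : ε ^ 2 * S = (lifetime ρ z₀).toReal + 1 := by
        rw [hS]
        field_simp
      have h3 := (clock_mem_halfOpen (ρ := ρ) hz hS0).2
      rw [ENNReal.ofReal_lt_iff_lt_toReal (clock_nonneg hz hS0) hfin] at h3
      linarith
    obtain ⟨x, hx, hxe⟩ := intermediate_value_Icc' hs0
      (continuous_relPos (ρ := ρ) (z₀ := z₀)).norm.continuousOn
      ⟨hs.le, by rw [relPos_zero]; exact hε.2.le⟩
    have hx0 : 0 < x := lt_of_le_of_ne hx.1 fun h0 => by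
      simp only [← h0, relPos_zero] at hxe
      exact hε.2.ne hxe.symm
    have hm := clock_mem_halfOpen (ρ := ρ) hz hx0.le
    refine lt_of_le_of_lt (sInf_le ⟨clock ρ z₀ x, ⟨⟨?_, hm.2⟩, ?_⟩, rfl⟩) (hm.2.trans ha)
    · have := strictMono_clock (ρ := ρ) hz hx0
      rwa [clock_zero] at this
    · rw [norm_driving_sub, clockInv_clock hz]
      exact hxe

theorem isSLEZeroDriving_driving (hz : z₀ ≠ 0) :
    IsSLEZeroDriving ρ z₀ (lifetime ρ z₀) (driving ρ z₀) (forcePoint ρ z₀) where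
  lifetime_pos := lifetime_pos hz
  initial := by simp [driving, clockInv_zero hz]
  forcePoint :=
    { initial := by simp [forcePoint, driving, clockInv_zero hz, relPos_zero]
      ne_driving := fun s _ h0 => by
        have := forcePoint_sub (ρ := ρ) (z₀ := z₀) s
        rw [h0, sub_self] at this
        exact relPos_ne_zero hz _ this.symm
      hasDeriv := fun s hs => (hasDerivAt_forcePoint hz hs).hasDerivWithinAt }
  drift := fun t ht => (hasDerivAt_driving hz ht).hasDerivWithinAt
  lifetime := tendsto_approachTime hz

end

theorem exists_isSLEZero (ρ : ℝ) {z₀ : ℂ} (hz : z₀ ≠ 0) :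
    ∃ (τ : ℝ≥0∞) (γ : ℝ → ℂ), IsSLEZero ρ z₀ τ γ :=
  ⟨lifetime ρ z₀, fun t => tip (driftFun ρ (driving ρ z₀) (forcePoint ρ z₀)) t t, driving ρ z₀,
    forcePoint ρ z₀, isSLEZeroDriving_driving hz,
    fun _ ht => (isSLEZeroDriving_driving hz).tendsto_loewnerInv ht⟩

/-! ### Flow lines -/

theorem div_norm_eq_exp_arg {w : ℂ} (hw : w ≠ 0) :
    w / ‖w‖ = Complex.exp (Complex.I * (Complex.arg w : ℂ)) := by
  have h := Complex.norm_mul_exp_arg_mul_I w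
  have hn : (‖w‖ : ℂ) ≠ 0 := by simpa using hw
  rw [div_eq_iff hn, mul_comm Complex.I, mul_comm _ (‖w‖ : ℂ), h]

theorem neg_two_mul_exp_div_norm {E g : ℂ} (hg : g ≠ 0) :
    -2 * Complex.exp E / g / ‖-2 * Complex.exp E / g‖ =
      Complex.exp (Complex.I * (Real.pi + E.im - Complex.arg g : ℝ)) := by
  have h1 := div_norm_eq_exp_arg hg
  have hn : (‖g‖ : ℂ) ≠ 0 := by simpa using hg
  have h2 : Complex.exp E = Real.exp E.re * Complex.exp (Complex.I * E.im) := by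
    conv_lhs => rw [← Complex.re_add_im E, Complex.exp_add, mul_comm (E.im : ℂ)]
    rw [Complex.ofReal_exp]
  have h3 : Complex.exp (Complex.I * (Real.pi + E.im - Complex.arg g : ℝ)) =
      -Complex.exp (Complex.I * E.im) / (g / ‖g‖) := by
    have e : Complex.I * ((Real.pi + E.im - Complex.arg g : ℝ) : ℂ) =
        Real.pi * Complex.I + Complex.I * E.im - Complex.I * Complex.arg g := by
      push_cast
      ring
    rw [e, Complex.exp_sub, Complex.exp_add, Complex.exp_pi_mul_I, h1]
    ring
  rw [h3, norm_div, norm_mul, norm_neg, Complex.norm_ofNat, Complex.norm_exp, h2]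
  have := Real.exp_ne_zero E.re
  have : (Real.exp E.re : ℂ) ≠ 0 := by exact_mod_cast this
  push_cast
  field_simp

namespace IsSLEZeroDriving

variable {ρ : ℝ} {z₀ : ℂ} {τ : ℝ≥0∞} {W : ℝ → ℝ} {Z : ℝ → ℂ} {γ : ℝ → ℂ} {t T : ℝ}

/-- The increment of `log (gₛ(γ(t)) - Zₛ)` between the times `t` and `0`. -/
def logIncr (ρ : ℝ) (W : ℝ → ℝ) (Z : ℝ → ℂ) : ℝ → ℂ :=
  tipIntegral (driftFun ρ W Z) fun s => 2 / (Z s - W s)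

/-- The increment of `log (gₛ(γ(t)) - conj Zₛ)` between the times `t` and `0`. -/
def logIncrConj (ρ : ℝ) (W : ℝ → ℝ) (Z : ℝ → ℂ) : ℝ → ℂ :=
  tipIntegral (driftFun ρ W Z) fun s => 2 / (starRingEnd ℂ) (Z s - W s)

/-- The velocity of the trace. -/
def velocity (ρ : ℝ) (W : ℝ → ℝ) (Z : ℝ → ℂ) (t : ℝ) : ℂ :=
  -2 * Complex.exp (-((ρ : ℂ) / 4) * (logIncr ρ W Z t + logIncrConj ρ W Z t)) /
    tip (driftFun ρ W Z) t t

theorem sub_ne_zero_Icc (h : IsSLEZeroDriving ρ z₀ τ W Z) (hT : T ∈ halfOpen τ) :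
    ∀ s ∈ Icc 0 T, Z s - W s ≠ 0 := fun _ hs => h.sub_ne_zero (Icc_subset_halfOpen hT.2 hs)

theorem conj_sub_ne_zero_Icc (h : IsSLEZeroDriving ρ z₀ τ W Z) (hT : T ∈ halfOpen τ) :
    ∀ s ∈ Icc 0 T, (starRingEnd ℂ) (Z s - W s) ≠ 0 := fun s hs => by
  rw [map_ne_zero]
  exact h.sub_ne_zero_Icc hT s hs

theorem hasDeriv_sub_Icc (h : IsSLEZeroDriving ρ z₀ τ W Z) (hT : T ∈ halfOpen τ) :
    ∀ s ∈ Icc 0 T, HasDerivWithinAt (fun s => Z s - W s)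
      (2 / (Z s - W s) - (driftFun ρ W Z s : ℂ)) (Icc 0 T) s := fun _ hs =>
  (h.hasDeriv_sub (Icc_subset_halfOpen hT.2 hs)).mono (Icc_subset_halfOpen hT.2)

theorem hasDeriv_conj_sub_Icc (h : IsSLEZeroDriving ρ z₀ τ W Z) (hT : T ∈ halfOpen τ) :
    ∀ s ∈ Icc 0 T, HasDerivWithinAt (fun s => (starRingEnd ℂ) (Z s - W s))
      (2 / (starRingEnd ℂ) (Z s - W s) - (driftFun ρ W Z s : ℂ)) (Icc 0 T) s := fun _ hs =>
  (h.hasDeriv_conj_sub (Icc_subset_halfOpen hT.2 hs)).mono (Icc_subset_halfOpen hT.2)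

theorem continuousOn_logIncr (h : IsSLEZeroDriving ρ z₀ τ W Z) :
    ContinuousOn (logIncr ρ W Z) (halfOpen τ) := continuousOn_halfOpen fun T hT => by
  obtain ⟨K, hK⟩ := h.exists_isDrift hT.2
  exact hK.continuousOn_tipIntegral
    (IsDrift.continuousOn_two_div (h.sub_ne_zero_Icc hT) (h.hasDeriv_sub_Icc hT))

theorem continuousOn_logIncrConj (h : IsSLEZeroDriving ρ z₀ τ W Z) :
    ContinuousOn (logIncrConj ρ W Z) (halfOpen τ) := continuousOn_halfOpen fun T hT => by
  obtain ⟨K, hK⟩ := h.exists_isDrift hT.2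
  exact hK.continuousOn_tipIntegral
    (IsDrift.continuousOn_two_div (h.conj_sub_ne_zero_Icc hT) (h.hasDeriv_conj_sub_Icc hT))

theorem continuousOn_trace (h : IsSLEZeroDriving ρ z₀ τ W Z) :
    ContinuousOn (fun t => tip (driftFun ρ W Z) t t) (halfOpen τ) :=
  continuousOn_halfOpen fun T hT => by
    obtain ⟨K, hK⟩ := h.exists_isDrift hT.2
    exact hK.continuousOn_trace

theorem im_trace_pos (h : IsSLEZeroDriving ρ z₀ τ W Z) (ht : t ∈ openInterval τ) :
    0 < (tip (driftFun ρ W Z) t t).im := by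
  obtain ⟨K, hK⟩ := h.exists_isDrift ht.2
  exact hK.im_tip_pos le_rfl ⟨ht.1, le_rfl⟩

theorem trace_ne_zero (h : IsSLEZeroDriving ρ z₀ τ W Z) (ht : t ∈ openInterval τ) :
    tip (driftFun ρ W Z) t t ≠ 0 := fun h0 => by simpa [h0] using h.im_trace_pos ht

theorem hasDerivAt_trace (h : IsSLEZeroDriving ρ z₀ τ W Z) (ht : t ∈ openInterval τ) :
    HasDerivAt (fun t => tip (driftFun ρ W Z) t t) (velocity ρ W Z t) t := by
  obtain ⟨T, htT, hT⟩ := exists_gt_of_mem_halfOpen (openInterval_subset_halfOpen τ ht)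
  obtain ⟨K, hK⟩ := h.exists_isDrift hT.2
  refine (hK.hasDerivAt_trace ⟨ht.1, htT⟩).congr_deriv ?_
  rw [velocity, hK.tipIntegral_linear ⟨ht.1.le, htT.le⟩
    (IsDrift.continuousOn_two_div (h.sub_ne_zero_Icc hT) (h.hasDeriv_sub_Icc hT))
    (IsDrift.continuousOn_two_div (h.conj_sub_ne_zero_Icc hT) (h.hasDeriv_conj_sub_Icc hT))
    fun s _ => driftFun_eq ρ W Z s]
  rfl

theorem trace_eq (h : IsSLEZeroDriving ρ z₀ τ W Z) (hγ : IsLoewnerTrace W (halfOpen τ) γ)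
    (ht : t ∈ halfOpen τ) : γ t = tip (driftFun ρ W Z) t t :=
  tendsto_nhds_unique (hγ t ht) (h.tendsto_loewnerInv ht)

theorem isRegularCurve (h : IsSLEZeroDriving ρ z₀ τ W Z)
    (hγ : IsLoewnerTrace W (halfOpen τ) γ) : IsRegularCurve τ γ (velocity ρ W Z) where
  lifetime_pos := h.lifetime_pos
  norm_sub_le := fun T hT => by
    obtain ⟨K, hK⟩ := h.exists_isDrift hT.2
    obtain ⟨C, hC0, hC⟩ := hK.exists_norm_trace_sub_le
    refine ⟨C, hC0, fun t₁ t₂ h1 h12 h2 => ?_⟩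
    have hsub := Icc_subset_halfOpen hT.2
    rw [h.trace_eq hγ (hsub ⟨h1, h12.trans h2⟩), h.trace_eq hγ (hsub ⟨h1.trans h12, h2⟩)]
    exact hC t₁ t₂ h1 h12 h2
  hasDeriv := fun t ht => by
    refine (h.hasDerivAt_trace ht).congr_of_eventuallyEq ?_
    filter_upwards [(isOpen_openInterval τ).mem_nhds ht] with s hs
    exact h.trace_eq hγ (openInterval_subset_halfOpen τ hs)
  velocity_ne_zero := fun t ht => div_ne_zero
    (mul_ne_zero (by norm_num) (Complex.exp_ne_zero _)) (h.trace_ne_zero ht)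
  continuousOn_velocity := by
    have hsub := openInterval_subset_halfOpen τ
    exact (continuousOn_const.mul (continuousOn_const.mul ((h.continuousOn_logIncr.mono hsub).add
      (h.continuousOn_logIncrConj.mono hsub))).cexp).div (h.continuousOn_trace.mono hsub)
      fun t ht => h.trace_ne_zero ht

theorem trace_zero (h : IsSLEZeroDriving ρ z₀ τ W Z) (hγ : IsLoewnerTrace W (halfOpen τ) γ) :
    γ 0 = 0 := by
  have h0 := zero_mem_halfOpen h.lifetime_pos
  obtain ⟨K, hK⟩ := h.exists_isDrift h0.2
  rw [h.trace_eq hγ h0, hK.tip_zero le_rfl le_rfl]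

theorem continuousOn_of_isLoewnerTrace (h : IsSLEZeroDriving ρ z₀ τ W Z)
    (hγ : IsLoewnerTrace W (halfOpen τ) γ) : ContinuousOn γ (halfOpen τ) :=
  h.continuousOn_trace.congr fun _ ht => h.trace_eq hγ ht

theorem velocity_div_norm (h : IsSLEZeroDriving ρ z₀ τ W Z)
    (hγ : IsLoewnerTrace W (halfOpen τ) γ) (ht : t ∈ openInterval τ) :
    velocity ρ W Z t / ‖velocity ρ W Z t‖ = Complex.exp (Complex.I *
      (Real.pi - Complex.arg (γ t) -
        ρ / 4 * ((logIncr ρ W Z t).im + (logIncrConj ρ W Z t).im) : ℝ)) := by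
  rw [velocity, neg_two_mul_exp_div_norm (h.trace_ne_zero ht),
    h.trace_eq hγ (openInterval_subset_halfOpen τ ht)]
  congr 3
  have e : -((ρ : ℂ) / 4) = ((-(ρ / 4) : ℝ) : ℂ) := by push_cast; ring
  rw [e, Complex.im_ofReal_mul, Complex.add_im]
  ring

theorem im_conj_sub_nonpos (h : IsSLEZeroDriving ρ z₀ τ W Z) (hz : 0 ≤ z₀.im)
    (ht : t ∈ halfOpen τ) : ((starRingEnd ℂ) (Z t - W t)).im ≤ 0 := by
  obtain ⟨c, hc, he⟩ := h.im_sub_eq ht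
  rw [Complex.conj_im, he, neg_nonpos]
  positivity

theorem sub_force_eq (h : IsSLEZeroDriving ρ z₀ τ W Z) (hγ : IsLoewnerTrace W (halfOpen τ) γ)
    (ht : t ∈ halfOpen τ) :
    γ t - z₀ = -(Z t - W t) * Complex.exp (logIncr ρ W Z t) := by
  obtain ⟨K, hK⟩ := h.exists_isDrift ht.2
  have := hK.trace_sub_eq ⟨ht.1, le_rfl⟩ (h.sub_ne_zero_Icc ht) (h.hasDeriv_sub_Icc ht)
  rw [h.sub_zero_eq, ← h.trace_eq hγ ht] at this
  exact this

theorem im_logIncrConj (h : IsSLEZeroDriving ρ z₀ τ W Z) (hz : 0 ≤ z₀.im)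
    (hγ : IsLoewnerTrace W (halfOpen τ) γ) (ht : t ∈ openInterval τ) :
    (logIncrConj ρ W Z t).im = Complex.arg (γ t - (starRingEnd ℂ) z₀) -
      Complex.arg (-(starRingEnd ℂ) (Z t - W t)) := by
  have ht' := openInterval_subset_halfOpen τ ht
  obtain ⟨K, hK⟩ := h.exists_isDrift ht.2
  have h1 := hK.log_trace_sub_eq ht.1 le_rfl (h.conj_sub_ne_zero_Icc ht')
    (h.hasDeriv_conj_sub_Icc ht') fun s hs =>
      h.im_conj_sub_nonpos hz (Icc_subset_halfOpen ht.2 hs)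
  have h2 := congrArg Complex.im h1
  rw [h.sub_zero_eq, ← h.trace_eq hγ ht', Complex.add_im, Complex.log_im, Complex.log_im] at h2
  rw [h2]
  simp [logIncrConj]

/-! ### Boundary force points -/

theorem conj_sub_eq_of_im_eq_zero (h : IsSLEZeroDriving ρ z₀ τ W Z) (hz : z₀.im = 0)
    (ht : t ∈ halfOpen τ) : (starRingEnd ℂ) (Z t - W t) = Z t - W t := by
  obtain ⟨c, -, he⟩ := h.im_sub_eq ht
  rw [hz, zero_mul] at he
  exact Complex.conj_eq_iff_im.2 he

/-- For a real force point the two logarithmic increments coincide, which turns the factor `ρ/4`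
into `ρ/2`. -/
theorem logIncr_eq_logIncrConj (h : IsSLEZeroDriving ρ z₀ τ W Z) (hz : z₀.im = 0)
    (ht : t ∈ halfOpen τ) : logIncr ρ W Z t = logIncrConj ρ W Z t := by
  refine intervalIntegral.integral_congr fun x hx => ?_
  rw [uIcc_of_le ht.1] at hx
  simp only [h.conj_sub_eq_of_im_eq_zero hz
    (Icc_subset_halfOpen ht.2 ⟨sub_nonneg.2 hx.2, by linarith [hx.1]⟩)]

/-- The real, continuous, nonvanishing difference `Z - W` cannot change sign, so the force point
stays on its side of the driving function. -/
theorem re_sub_mul_pos (h : IsSLEZeroDriving ρ z₀ τ W Z) (hz : z₀.im = 0)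
    (ht : t ∈ halfOpen τ) : 0 < (Z t - W t).re * z₀.re := by
  have hne : ∀ s ∈ Icc 0 t, (Z s - W s).re * z₀.re ≠ 0 := fun s hs => by
    have hs' := Icc_subset_halfOpen ht.2 hs
    have h1 := h.sub_ne_zero hs'
    have h2 := Complex.conj_eq_iff_im.1 (h.conj_sub_eq_of_im_eq_zero hz hs')
    have h3 := h.sub_ne_zero (zero_mem_halfOpen h.lifetime_pos)
    rw [h.sub_zero_eq] at h3
    exact mul_ne_zero (fun h0 => h1 (Complex.ext h0 h2)) fun h0 => h3 (Complex.ext h0 hz)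
  have hc : ContinuousOn (fun s => (Z s - W s).re * z₀.re) (Icc 0 t) :=
    (Complex.continuous_re.comp_continuousOn (h.continuousOn_sub.mono
      (Icc_subset_halfOpen ht.2))).mul continuousOn_const
  have h0 : 0 < (Z 0 - W 0).re * z₀.re := by
    refine lt_of_le_of_ne ?_ (hne 0 ⟨le_rfl, ht.1⟩).symm
    rw [h.sub_zero_eq]
    exact mul_self_nonneg _
  by_contra hneg
  obtain ⟨s, hs, hs0⟩ := intermediate_value_Icc' ht.1 hc ⟨not_lt.1 hneg, h0.le⟩
  exact hne s hs hs0

theorem isFlowLineOn_boundary (h : IsSLEZeroDriving ρ z₀ τ W Z) (hz : z₀.im = 0)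
    (hγ : IsLoewnerTrace W (halfOpen τ) γ) :
    IsFlowLineOn id upperHalf (boundaryField ρ z₀.re) (openInterval (totalLength τ γ))
      (arcLengthParam τ γ) := by
  have hr := h.isRegularCurve hγ
  refine ⟨fun s hs => ?_, fun s hs => ?_, ?_, ?_, fun s hs => ?_⟩
  · have hm := hr.arcTime_mem_openInterval hs
    have := h.im_trace_pos hm
    rwa [← h.trace_eq hγ (openInterval_subset_halfOpen τ hm)] at this
  · exact (hr.hasDerivAt_arcLengthParam hs).continuousAt.continuousWithinAt
  · exact hr.contDiffOn_arcLengthParam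
  · exact hr.hasUnitSpeedOn_arcLengthParam
  · have hm := hr.arcTime_mem_openInterval hs
    refine (hr.hasDerivAt_arcLengthParam hs).congr_deriv ?_
    rw [h.velocity_div_norm hγ hm, arcLengthParam_eq, Function.comp_apply]
    set t := arcTime τ γ s
    have hm' := openInterval_subset_halfOpen τ hm
    have hreal : z₀ = (z₀.re : ℂ) := Complex.ext rfl (by simp [hz])
    have hconj : (starRingEnd ℂ) z₀ = (z₀.re : ℂ) := by
      rw [Complex.conj_eq_iff_im.2 hz, ← hreal]
    have hA : Z t - W t = ((Z t - W t).re : ℂ) := Complex.ext rfl (by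
      simpa using Complex.conj_eq_iff_im.1 (h.conj_sub_eq_of_im_eq_zero hz hm'))
    have hsgn := h.re_sub_mul_pos hz hm'
    congr 3
    rw [h.logIncr_eq_logIncrConj hz hm', h.im_logIncrConj hz.ge hγ hm, hconj,
      h.conj_sub_eq_of_im_eq_zero hz hm', hA, ← Complex.ofReal_neg]
    rw [boundaryField]
    -- The two formulas differ by `arg(-(Z - W))`: it is `π` for a force point on the right, giving
    -- the extra `πρ/2`, and `0` on the left.
    split_ifs with hpos
    · have : 0 < (Z t - W t).re := pos_of_mul_pos_left hsgn hpos.le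
      rw [Complex.arg_ofReal_of_neg (neg_lt_zero.2 this)]
      ring
    · have : (Z t - W t).re ≤ 0 := by
        by_contra hcon
        exact absurd hsgn (not_lt.2 (mul_nonpos_of_nonneg_of_nonpos (not_le.1 hcon).le
          (not_lt.1 hpos)))
      rw [Complex.arg_ofReal_of_nonneg (neg_nonneg.2 this)]
      ring

/-! ### Interior force points -/

/-- The angle of the lift of the trace to the logarithmic Riemann surface. -/
def liftAngle (ρ : ℝ) (W : ℝ → ℝ) (Z : ℝ → ℂ) (t : ℝ) : ℝ :=
  Complex.arg (Z t - W t) - Real.pi + (logIncr ρ W Z t).im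

theorem im_sub_pos (h : IsSLEZeroDriving ρ z₀ τ W Z) (hz : 0 < z₀.im) (ht : t ∈ halfOpen τ) :
    0 < (Z t - W t).im := by
  obtain ⟨c, hc, he⟩ := h.im_sub_eq ht
  rw [he]
  positivity

theorem continuousOn_liftAngle (h : IsSLEZeroDriving ρ z₀ τ W Z) (hz : 0 < z₀.im) :
    ContinuousOn (liftAngle ρ W Z) (halfOpen τ) := by
  refine ContinuousOn.add (ContinuousOn.sub (fun t ht => ?_) continuousOn_const)
    (Complex.continuous_im.comp_continuousOn h.continuousOn_logIncr)
  exact ContinuousAt.comp_continuousWithinAt (f := fun t => Z t - (W t : ℂ))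
    (Complex.continuousAt_arg (Or.inr (h.im_sub_pos hz ht).ne')) (h.continuousOn_sub t ht)

/-- The trace avoids the force point, so the radial coordinate of the lift is positive and the
default value in `liftCurve` is never used on the lifetime. -/
theorem trace_ne_force (h : IsSLEZeroDriving ρ z₀ τ W Z)
    (hγ : IsLoewnerTrace W (halfOpen τ) γ) (ht : t ∈ halfOpen τ) : γ t - z₀ ≠ 0 := by
  rw [h.sub_force_eq hγ ht]
  exact mul_ne_zero (neg_ne_zero.2 (h.sub_ne_zero ht)) (Complex.exp_ne_zero _)

theorem trace_eq_polar (h : IsSLEZeroDriving ρ z₀ τ W Z)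
    (hγ : IsLoewnerTrace W (halfOpen τ) γ) (ht : t ∈ halfOpen τ) :
    z₀ + (‖γ t - z₀‖ : ℂ) * Complex.exp (Complex.I * (liftAngle ρ W Z t : ℂ)) = γ t := by
  rw [← eq_sub_iff_add_eq']
  have h1 := h.sub_force_eq hγ ht
  have h2 : ‖γ t - z₀‖ = ‖Z t - W t‖ * Real.exp (logIncr ρ W Z t).re := by
    rw [h1, norm_mul, norm_neg, Complex.norm_exp]
  have h3 := Complex.norm_mul_exp_arg_mul_I (Z t - W t)
  have e : Complex.I * (liftAngle ρ W Z t : ℂ) = Complex.arg (Z t - W t) * Complex.I -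
      Real.pi * Complex.I + (logIncr ρ W Z t).im * Complex.I := by
    rw [liftAngle]
    push_cast
    ring
  rw [h2, e, Complex.exp_add, Complex.exp_sub, Complex.exp_pi_mul_I, h1]
  conv_rhs => rw [← h3, ← Complex.re_add_im (logIncr ρ W Z t), Complex.exp_add]
  push_cast
  ring

open Classical in
/-- The lift of the trace to the logarithmic Riemann surface. -/
def liftCurve (ρ : ℝ) (z₀ : ℂ) (W : ℝ → ℝ) (Z : ℝ → ℂ) (γ : ℝ → ℂ) (t : ℝ) : LogSurface :=
  if ht : 0 < ‖γ t - z₀‖ then ⟨(‖γ t - z₀‖, liftAngle ρ W Z t), ht⟩ else ⟨(1, 0), one_pos⟩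

theorem liftCurve_coe (h : IsSLEZeroDriving ρ z₀ τ W Z)
    (hγ : IsLoewnerTrace W (halfOpen τ) γ) (ht : t ∈ halfOpen τ) :
    (liftCurve ρ z₀ W Z γ t).1 = (‖γ t - z₀‖, liftAngle ρ W Z t) := by
  rw [liftCurve, dif_pos (norm_pos_iff.2 (h.trace_ne_force hγ ht))]

theorem continuousOn_liftCurve (h : IsSLEZeroDriving ρ z₀ τ W Z) (hz : 0 < z₀.im)
    (hγ : IsLoewnerTrace W (halfOpen τ) γ) :
    ContinuousOn (liftCurve ρ z₀ W Z γ) (halfOpen τ) := by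
  refine Topology.IsInducing.subtypeVal.continuousOn_iff.2 ?_
  exact (((h.continuousOn_of_isLoewnerTrace hγ).sub continuousOn_const).norm.prodMk
    (h.continuousOn_liftAngle hz)).congr fun t ht => h.liftCurve_coe hγ ht

theorem logProj_liftCurve (h : IsSLEZeroDriving ρ z₀ τ W Z)
    (hγ : IsLoewnerTrace W (halfOpen τ) γ) (ht : t ∈ halfOpen τ) :
    logProj z₀ (liftCurve ρ z₀ W Z γ t) = γ t := by
  rw [logProj, h.liftCurve_coe hγ ht]
  exact h.trace_eq_polar hγ ht

/-- At time `0` the direction from `z₀` to the trace is that of `-z₀`; the shift by `-π` in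
`liftAngle` selects the prescribed sheet. -/
theorem liftAngle_zero (h : IsSLEZeroDriving ρ z₀ τ W Z) :
    liftAngle ρ W Z 0 = Complex.arg z₀ - Real.pi := by
  simp [liftAngle, logIncr, tipIntegral, h.sub_zero_eq]

/-- With `A = Z - W`, the terminal contributions are `arg A - π` in the lift angle and `arg(-conj A)
= π - arg A` in the conjugate argument. They cancel, so the field sees only the two increments and
has no additive constant depending on time. -/
theorem interiorField_liftCurve (h : IsSLEZeroDriving ρ z₀ τ W Z) (hz : 0 < z₀.im)
    (hγ : IsLoewnerTrace W (halfOpen τ) γ) (ht : t ∈ openInterval τ) :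
    interiorField ρ z₀ (liftCurve ρ z₀ W Z γ t) = Real.pi - Complex.arg (γ t) -
      ρ / 4 * ((logIncr ρ W Z t).im + (logIncrConj ρ W Z t).im) := by
  have ht' := openInterval_subset_halfOpen τ ht
  have hA := h.im_sub_pos hz ht'
  have harg : Complex.arg (-(starRingEnd ℂ) (Z t - W t)) =
      Real.pi - Complex.arg (Z t - W t) := by
    have hne : Complex.arg (Z t - W t) ≠ Real.pi := fun h0 =>
      hA.ne' (Complex.arg_eq_pi_iff.1 h0).2
    rw [Complex.arg_neg_eq_arg_add_pi_of_im_neg (by simpa using hA), Complex.arg_conj,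
      if_neg hne]
    ring
  rw [interiorField, h.logProj_liftCurve hγ ht', h.liftCurve_coe hγ ht',
    h.im_logIncrConj hz.le hγ ht, harg, liftAngle]
  ring

theorem isLogLift (h : IsSLEZeroDriving ρ z₀ τ W Z) (hz : 0 < z₀.im)
    (hγ : IsLoewnerTrace W (halfOpen τ) γ) :
    IsLogLift z₀ ‖z₀‖ (Complex.arg z₀ - Real.pi) (halfOpen (totalLength τ γ))
      (arcLengthParam τ γ) (liftCurve ρ z₀ W Z γ ∘ arcTime τ γ) := by
  have hr := h.isRegularCurve hγ
  refine ⟨(h.continuousOn_liftCurve hz hγ).comp hr.continuousOn_arcTime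
    fun s hs => hr.arcTime_mem hs, ?_, fun s hs => ?_⟩
  · rw [Function.comp_apply, hr.arcTime_zero,
      h.liftCurve_coe hγ (zero_mem_halfOpen h.lifetime_pos), h.liftAngle_zero, h.trace_zero hγ,
      zero_sub, norm_neg]
  · exact h.logProj_liftCurve hγ (hr.arcTime_mem hs)

theorem isFlowLineOn_interior (h : IsSLEZeroDriving ρ z₀ τ W Z) (hz : 0 < z₀.im)
    (hγ : IsLoewnerTrace W (halfOpen τ) γ) :
    IsFlowLineOn (logProj z₀) (logUpperHalf z₀) (interiorField ρ z₀)
      (openInterval (totalLength τ γ)) (liftCurve ρ z₀ W Z γ ∘ arcTime τ γ) := by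
  have hr := h.isRegularCurve hγ
  have hl := h.isLogLift hz hγ
  have hsub := openInterval_subset_halfOpen (totalLength τ γ)
  have heq : EqOn (logProj z₀ ∘ liftCurve ρ z₀ W Z γ ∘ arcTime τ γ) (arcLengthParam τ γ)
      (openInterval (totalLength τ γ)) := fun s hs => hl.proj s (hsub hs)
  refine ⟨fun s hs => ?_, hl.continuousOn.mono hsub, hr.contDiffOn_arcLengthParam.congr heq, ?_,
    fun s hs => ?_⟩
  · have hm := hr.arcTime_mem_openInterval hs
    have := h.im_trace_pos hm
    rw [← h.trace_eq hγ (openInterval_subset_halfOpen τ hm)] at this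
    change 0 < (logProj z₀ _).im
    rwa [hl.proj s (hsub hs)]
  · intro x hx y hy
    rw [← hr.hasUnitSpeedOn_arcLengthParam hx hy]
    exact eVariationOn.eq_of_eqOn fun z hz => heq hz.1
  · have hm := hr.arcTime_mem_openInterval hs
    have h1 := (hr.hasDerivAt_arcLengthParam hs).congr_of_eventuallyEq
      (heq.eventuallyEq_of_mem ((isOpen_openInterval _).mem_nhds hs))
    refine h1.congr_deriv ?_
    rw [h.velocity_div_norm hγ hm, Function.comp_apply, h.interiorField_liftCurve hz hγ hm]

end IsSLEZeroDriving

end SLEZero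

end

/-! ### The proposition -/

theorem proposition4p1 (ρ : ℝ) (z₀ : ℂ) (hz₀_im : 0 ≤ z₀.im) (hz₀_ne : z₀ ≠ 0) :
    (∃ (τ : ENNReal) (γ : ℝ → ℂ), SLEZero.IsSLEZero ρ z₀ τ γ) ∧
    ∀ (τ : ENNReal) (γ : ℝ → ℂ), SLEZero.IsSLEZero ρ z₀ τ γ →
      γ 0 = 0 ∧
      ContinuousOn γ (SLEZero.halfOpen τ) ∧
      LocallyBoundedVariationOn γ (SLEZero.halfOpen τ) ∧
      (z₀.im = 0 →
        SLEZero.IsFlowLineOn id SLEZero.upperHalf (SLEZero.boundaryField ρ z₀.re)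
          (SLEZero.openInterval (SLEZero.totalLength τ γ)) (SLEZero.arcLengthParam τ γ)) ∧
      (0 < z₀.im →
        ∃ η' : ℝ → SLEZero.LogSurface,
          SLEZero.IsLogLift z₀ ‖z₀‖ (Complex.arg z₀ - Real.pi)
            (SLEZero.halfOpen (SLEZero.totalLength τ γ)) (SLEZero.arcLengthParam τ γ) η' ∧
          SLEZero.IsFlowLineOn (SLEZero.logProj z₀) (SLEZero.logUpperHalf z₀)
            (SLEZero.interiorField ρ z₀)
            (SLEZero.openInterval (SLEZero.totalLength τ γ)) η') := by
  refine ⟨SLEZero.exists_isSLEZero ρ hz₀_ne, ?_⟩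
  rintro τ γ ⟨W, Z, h, hγ⟩
  exact ⟨h.trace_zero hγ, h.continuousOn_of_isLoewnerTrace hγ,
    (h.isRegularCurve hγ).locallyBoundedVariationOn, fun hz => h.isFlowLineOn_boundary hz hγ,
    fun hz => ⟨_, h.isLogLift hz hγ, h.isFlowLineOn_interior hz hγ⟩⟩
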